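/- Let $Q=[0,1]^2$ be the flat unit square, with sides $A,B,C,D$ in consecutive order (elementary regions $A_1,\dots,A_4$; $AB=A\cup B$, etc.). For a union $A_I=\bigcup_{i\in I}A_i$ of sides, let $S(A_I)$ be the infimum of the lengths ($\mathcal H^1$) of the curves homologous to $A_I$, i.e. of the boundaries relative to $Q$ of subsets $r\subseteq Q$ that meet $\partial Q$ in $A_I$. A $\nu_v$-multiflow is a family of bounded measurable vector fields $v_{ij}$ ($1\le i<j\le 4$) on $Q$ with $\nabla\cdot v_{ij}=0$ and with normal component $\hat n\cdot v_{ij}=0$ on $A_k$ for $k\ne i,j$ (both in the weak sense), and $\sum_{i<j}|v_{ij}|\le1$ a.e. Put $v_I=\sum_{i<j,\,i\in I,\,j\notin I}v_{ij}-\sum_{i<j,\,i\notin I,\,j\in I}v_{ij}$, and let $\int_{A_I}v_I$ be its inward flux through $A_I$. A thread configuration is a measure on a measurable family of rectifiable curves of positive length in $Q$, each closed or with both endpoints on $\partial Q$. It obeys $\nu_v\le1$ if the total length of threads in every measurable subset of $Q$ is at most the area of the subset. Let $N_{A_I}$ be the number (measure) of threads that connect $A_I$ with $A_{\bar I}$,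 $\bar I$ being the complement of $I$ in $\{1,2,3,4\}$; the configuration locks $A_I$ if $N_{A_I}=S(A_I)$. A thread configuration underlies a multiflow if it is divided into bundles indexed by the pairs $i<j$, the threads of the bundle $ij$ being tangent to $v_{ij}$ with length density $|v_{ij}|$. Then: 1. The two diagonals are minimal curves homologous to $AB$ and to $BC$ respectively, and $S(AB)=S(BC)=\sqrt2$; in particular $2+\tfrac{\sqrt2}{2}<2\sqrt2=S(AB)+S(BC)$. 2. Let $N_{ij}$ be the number of the regions $AB$, $BC$ that contain exactly one of $A_i$, $A_j$. Let $\lambda$ be the constant $2$ plus delta functions along the two diagonals with weight $\max(0,1-2\sqrt2\,\rho)$, where $\rho$ is the distance to the nearest corner, understood as the limit $\varepsilon\to0^+$ of the continuous functions obtained by smearing the delta functions over the width $\varepsilon$ with a tent profile. Then $\lambda\ge0$ is feasible for the dual program: $\int_c\lambda\,ds\ge N_{ij}$ in the limit (as a $\liminf$) for all $i<j$ and every rectifiable curve $c$ in $Q$ from $A_i$ to $A_j$ with endpoints off the corners. Its objective is $\int_Q\lambda=2+\tfrac{\sqrt2}{2}$. 3. Every $\nu_v$-multiflow satisfies $\int_{AB}v_{AB}+\int_{BC}v_{BC}\le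 2+\tfrac{\sqrt2}{2}$, where $v_{AB}$, $v_{BC}$ denote $v_I$ for $I=\{1,2\}$, $\{2,3\}$. Hence no $\nu_v$-multiflow locks both $AB$ and $BC$: the fluxes are not both equal to $S(AB)$, $S(BC)$, and no thread configuration underlying the multiflow locks both regions. 4. Every thread configuration with $\nu_v\le1$ satisfies $N_{AB}+N_{BC}\le 2+\tfrac{\sqrt2}{2}$. Hence none locks both $AB$ and $BC$. -/

import Mathlib

open MeasureTheory Set Filter Topology
open scoped ENNReal ContDiff

noncomputable section

namespace BitThread

/-! ## The flat unit square, its sides, and composite boundary regions -/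

/-- The Euclidean plane. -/
abbrev Plane : Type := EuclideanSpace ℝ (Fin 2)

/-- The closed unit square `[0,1] × [0,1]` with the flat metric. -/
def square : Set Plane := {x | ∀ i, x i ∈ Icc (0 : ℝ) 1}

/-- Arc-length parametrizations, by `t ∈ [0,1]`, of the four sides in cyclic order:
`0 = A` (left), `1 = B` (bottom), `2 = C` (right), `3 = D` (top). -/
def sidePoint (k : Fin 4) (t : ℝ) : Plane :=
  match k with
  | 0 => !₂[0, t]
  | 1 => !₂[t, 0]
  | 2 => !₂[1, t]
  | 3 => !₂[t, 1]

/-- The elementary boundary region `A_k`: a closed side. -/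
def side (k : Fin 4) : Set Plane := sidePoint k '' Icc 0 1

/-- A side without its two corners. -/
def openSide (k : Fin 4) : Set Plane := sidePoint k '' Ioo 0 1

/-- The composite region `A_I`, the union of the sides with index in `I`. -/
def region (I : Finset (Fin 4)) : Set Plane := ⋃ k ∈ I, side k

/-- The index set of the composite region `AB`. -/
def AB : Finset (Fin 4) := {0, 1}

/-- The index set of the composite region `BC`. -/
def BC : Finset (Fin 4) := {1, 2}

/-- The diagonal from the corner `D ∩ A` to the corner `B ∩ C`. -/
def diagAB : Set Plane := segment ℝ (!₂[0, 1] : Plane) !₂[1, 0]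

/-- The diagonal from the corner `A ∩ B` to the corner `C ∩ D`. -/
def diagBC : Set Plane := segment ℝ (!₂[0, 0] : Plane) !₂[1, 1]

/-! ## Homologous surfaces and minimal area -/

/-- `m` is a (relative) hypersurface homologous to the boundary region `A_I`: there is a bulk
region `r` that meets the boundary of the square in `A_I` (it is a neighbourhood, in the square, of
the points of `A_I` off the complementary region, and its complement is a neighbourhood of
the points of the complementary region off `A_I`), and `m` is the rest of the boundary of `r`,
that is, the topological boundary of `r` relative to the square. -/
def IsHomologousSurface (I : Finset (Fin 4)) (m : Set Plane) : Prop :=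
  ∃ r : Set Plane, r ⊆ square ∧
    (∀ x ∈ region I \ region Iᶜ, r ∈ 𝓝[square] x) ∧
    (∀ x ∈ region Iᶜ \ region I, square \ r ∈ 𝓝[square] x) ∧
    m = closure r ∩ closure (square \ r)

/-- `S(A_I)`: the least area (length, as the square is two-dimensional) of a surface homologous
to `A_I`. -/
def S (I : Finset (Fin 4)) : ℝ≥0∞ :=
  ⨅ (m : Set Plane) (_ : IsHomologousSurface I m), μH[1] m

/-! ## Multiflows -/

/-- The index pairs `i < j`. -/
def pairs : Finset (Fin 4 × Fin 4) := Finset.univ.filter fun p => p.1 < p.2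

/-- `v` is divergenceless in the square and has on the side `k`, at the point `sidePoint k t`,
the inward normal component `g k t`; both in the weak sense, through Green's formula. (Test
functions supported in the open square give `∇ · v = 0` in the sense of distributions; the others
determine `g` almost everywhere.) -/
def IsDivFreeWithTrace (v : Plane → Plane) (g : Fin 4 → ℝ → ℝ) : Prop :=
  (∀ k, IntegrableOn (g k) (Icc 0 1)) ∧
  ∀ φ : Plane → ℝ, ContDiff ℝ ∞ φ →
    ∫ x in square, fderiv ℝ φ x (v x) =
      - ∑ k, ∫ t in (0 : ℝ)..1, g k t * φ (sidePoint k t)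

/-- A `ν_v`-multiflow on the square: bounded measurable vector fields `v_ij` (`i < j`), weakly
divergenceless, with vanishing normal component on the sides `k ≠ i, j`, and with
`ν_v = ∑_{i<j} |v_ij| ≤ 1` almost everywhere. Only the components with `i < j` are used. -/
structure NuVMultiflow where
  /-- the component flows `v_ij` -/
  field : Fin 4 × Fin 4 → Plane → Plane
  /-- `trace (i, j) k t` is the inward normal component of `v_ij` at `sidePoint k t` -/
  trace : Fin 4 × Fin 4 → Fin 4 → ℝ → ℝ
  aestronglyMeasurable : ∀ p ∈ pairs, AEStronglyMeasurable (field p) (volume.restrict square)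
  divFree : ∀ p ∈ pairs, IsDivFreeWithTrace (field p) (trace p)
  trace_eq_zero : ∀ p ∈ pairs, ∀ k, k ≠ p.1 → k ≠ p.2 →
    ∀ᵐ t ∂(volume.restrict (Icc (0 : ℝ) 1)), trace p k t = 0
  density_le : ∀ᵐ x ∂(volume.restrict square), ∑ p ∈ pairs, ‖field p x‖ ≤ 1

/-- The coefficient of `v_ij` in the flow `v_I` from `A_I` to the complementary region. -/
def crossSign (I : Finset (Fin 4)) (p : Fin 4 × Fin 4) : ℝ :=
  if p.1 ∈ I ∧ p.2 ∉ I then 1 else if p.1 ∉ I ∧ p.2 ∈ I then -1 else 0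

/-- The flux through `A_I` of the flow
`v_I = ∑_{i<j, i ∈ I, j ∉ I} v_ij - ∑_{i<j, i ∉ I, j ∈ I} v_ij`. -/
def NuVMultiflow.flux (V : NuVMultiflow) (I : Finset (Fin 4)) : ℝ :=
  ∑ k ∈ I, ∫ t in (0 : ℝ)..1, ∑ p ∈ pairs, crossSign I p * V.trace p k t

/-- The multiflow saturates the flux bound of every region of the family. -/
def NuVMultiflow.LocksByFlux (V : NuVMultiflow) (F : Finset (Finset (Fin 4))) : Prop :=
  ∀ I ∈ F, V.flux I = (S I).toReal

/-! ## Thread configurations -/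

/-- A thread configuration: a measure on a family of rectifiable curves of positive length in the
square, parametrized by arc length, each of which is closed or has both its endpoints on
the boundary. The direction of the parametrization plays no role. -/
structure ThreadConfiguration (Ω : Type*) [MeasurableSpace Ω] where
  /-- the measure that counts threads -/
  weight : Measure Ω
  /-- the length of a thread -/
  len : Ω → ℝ
  /-- `path w t`, for `0 ≤ t ≤ len w`, is the point of the thread `w` at arc length `t` -/
  path : Ω → ℝ → Plane
  len_pos : ∀ w, 0 < len w
  measurable_len : Measurable len
  measurable_path : Measurable fun p : Ω × ℝ => path p.1 p.2
  unitSpeed : ∀ w, HasUnitSpeedOn (path w) (Icc 0 (len w))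
  mem_square : ∀ w, ∀ t ∈ Icc 0 (len w), path w t ∈ square
  ends : ∀ w, (path w 0 ∈ region Finset.univ ∧ path w (len w) ∈ region Finset.univ) ∨
    path w 0 = path w (len w)

namespace ThreadConfiguration

variable {Ω : Type*} [MeasurableSpace Ω]

/-- The length (with multiplicity) of the part of the thread `w` that lies in `U`. -/
def lengthIn (P : ThreadConfiguration Ω) (w : Ω) (U : Set Plane) : ℝ≥0∞ :=
  volume {t : ℝ | t ∈ Icc 0 (P.len w) ∧ P.path w t ∈ U}

/-- `ν_v ≤ 1`: the total length of threads in any part of the square is at most its volume. -/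
def NuVLeOne (P : ThreadConfiguration Ω) : Prop :=
  ∀ U : Set Plane, MeasurableSet U → U ⊆ square →
    ∫⁻ w, P.lengthIn w U ∂P.weight ≤ volume U

/-- The number of threads that connect `A_I` with the complementary region. -/
def number (P : ThreadConfiguration Ω) (I : Finset (Fin 4)) : ℝ≥0∞ :=
  P.weight {w | (P.path w 0 ∈ region I ∧ P.path w (P.len w) ∈ region Iᶜ) ∨
    (P.path w 0 ∈ region Iᶜ ∧ P.path w (P.len w) ∈ region I)}

/-- The configuration locks every region of the family. -/
def Locks (P : ThreadConfiguration Ω) (F : Finset (Finset (Fin 4))) : Prop :=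
  ∀ I ∈ F, P.number I = S I

/-- `P` is a thread configuration underlying the multiflow `V`: its threads are divided into
bundles, and those of the bundle `ij` are tangent to `v_ij` and have density `|v_ij|`. -/
def Underlies (P : ThreadConfiguration Ω) (V : NuVMultiflow) : Prop :=
  ∃ bundle : Ω → Fin 4 × Fin 4, Measurable bundle ∧ (∀ w, bundle w ∈ pairs) ∧
    ∀ p ∈ pairs,
      (∀ U : Set Plane, MeasurableSet U → U ⊆ square →
        ∫⁻ w in bundle ⁻¹' {p}, P.lengthIn w U ∂P.weight = ∫⁻ x in U, ‖V.field p x‖ₑ) ∧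
      ∀ᵐ w ∂(P.weight.restrict (bundle ⁻¹' {p})),
        ∀ᵐ t ∂(volume.restrict (Icc 0 (P.len w))),
          ∃ c : ℝ, deriv (P.path w) t = c • V.field p (P.path w t)

end ThreadConfiguration

/-! ## The dual program -/

/-- `N_ij`, the number of members of the family that separate `i` from `j`. -/
def sepNumber (F : Finset (Finset (Fin 4))) (i j : Fin 4) : ℕ :=
  (F.filter fun I => i ∈ I ∧ j ∉ I).card + (F.filter fun I => j ∈ I ∧ i ∉ I).card

/-- The distance `ρ` to the nearest corner of the square. -/
def cornerDist (x : Plane) : ℝ :=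
  Metric.infDist x {!₂[0, 0], !₂[1, 0], !₂[0, 1], !₂[1, 1]}

/-- The weight `1 - 2√2 ρ` of the delta functions, terminated at `ρ = 1 / (2√2)`. -/
def diagWeight (x : Plane) : ℝ := max 0 (1 - 2 * √2 * cornerDist x)

/-- A continuous approximation, of width `ε`, to the delta function on a line at distance `s`. -/
def tent (ε s : ℝ) : ℝ := max 0 (1 - s / ε) / ε

/-- The function `λ`: the constant `2` plus weighted delta functions along the two diagonals,
the delta functions being smeared over the width `ε`. -/
def dualFun (ε : ℝ) (x : Plane) : ℝ :=
  2 + diagWeight x * (tent ε (Metric.infDist x diagAB) + tent ε (Metric.infDist x diagBC))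

/-- Feasibility for the dual program of the family `F` of a nonnegative generalized function,
given as the limit, as `ε → 0+`, of continuous functions `lam ε`: the line integral along each curve
from the side `i` to the side `j` (rectifiable, in the square, parametrized by arc length, with
endpoints off the corners, where `i` and `j` may meet) is at least `N_ij` in the limit. -/
def IsDualFeasible (F : Finset (Finset (Fin 4))) (lam : ℝ → Plane → ℝ) : Prop :=
  (∀ ε > 0, ContinuousOn (lam ε) square ∧ ∀ x ∈ square, 0 ≤ lam ε x) ∧
  ∀ i j : Fin 4, i < j → ∀ (L : ℝ) (c : ℝ → Plane), 0 < L → HasUnitSpeedOn c (Icc 0 L) →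
    (∀ t ∈ Icc 0 L, c t ∈ square) → c 0 ∈ openSide i → c L ∈ openSide j →
      (sepNumber F i j : ℝ≥0∞) ≤
        liminf (fun ε => ∫⁻ t in Icc 0 L, ENNReal.ofReal (lam ε (c t))) (𝓝[>] 0)

/-- The dual objective `∫ λ` of the limit `ε → 0+` of the functions `lam ε` has the value `a`. -/
def HasDualObjective (lam : ℝ → Plane → ℝ) (a : ℝ) : Prop :=
  Tendsto (fun ε => ∫ x in square, lam ε x) (𝓝[>] 0) (𝓝 a)

end BitThread

end

open BitThread

namespace BitThread

/-! ## Affine functions on the square -/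

/-! All bounds on `AB` and `BC` together are weak duality against one function λ: the constant 2
plus a weight max(0, 1 - 2√2 ρ) on the two diagonals.

Feasibility. A curve joining opposite sides has length at least 1, so the constant alone contributes
2. A curve of length L joining adjacent sides must cross the diagonal through their common corner.
At the crossing both side distances equal some a, with 2a ≤ L because the curve starts on one side
and ends on the other. The distance ρ to the nearest corner is at most √2 a, so the weight is at
least 1 - 2L, and the total is at least 2L + (1 - 2L) = 1. `dualFun_integral_of_adjacent` is this
argument with the delta functions smeared. The objective is 2 plus four triangles of base 1/(2√2)
and height 1, which add √2/2 (`hasDualObjective_dualFun`).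

Threads. Almost every thread has its endpoints off the corners (`ae_endpoint_ne`), so feasibility
bounds the number of regions that it crosses. Integrating over the threads, with Fatou's lemma for
the limit of the smeared functions and the density bound in the form `lintegral_path_le`, gives
`number_add_number_le`.

Multiflows. No decomposition of a flow into threads is made. Each component v_ij is paired, through
Green's formula, with a smooth potential that rises by N_ij from side i to side j. For opposite
sides it is linear of slope 2. For adjacent sides it rises from 0 with slope about 2 away from i,
reaches 1 with slope about 2 towards j, and makes up the difference by a steep step across the
diagonal. The jump there is the diagonal weight near the common corner. Hence one bound
`gradientBound`, an approximation of λ, controls all the gradients, and ∑|v_ij| ≤ 1 gives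
`flux_add_flux_le` after two limits, first in the width of the step and then in the smoothing of the
slope.

Minimal curves. The coordinate along a diagonal is 1-Lipschitz, and each of its level lines through
the open square joins the region to its complement. A homologous curve therefore projects onto an
interval of length √2, the length of the diagonal. Locking both regions would need 2√2, which
exceeds 2 + √2/2. -/

/-- The distance from the line that carries the side `k`, positive inside the square. -/
noncomputable def sideDist (k : Fin 4) (x : Plane) : ℝ :=
  match k with
  | 0 => x 0
  | 1 => x 1
  | 2 => 1 - x 0
  | 3 => 1 - x 1

/-- The sides `k` and `l` share a corner. -/
def Adjacent (k l : Fin 4) : Prop := k ≠ l ∧ k ≠ l + 2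

instance (k l : Fin 4) : Decidable (Adjacent k l) := inferInstanceAs (Decidable (_ ∧ _))

theorem Adjacent.symm {k l : Fin 4} (h : Adjacent k l) : Adjacent l k := by
  revert k l; decide

theorem abs_lincomb_le (a b : ℝ) (x : Plane) :
    |a * x 0 + b * x 1| ≤ √(a ^ 2 + b ^ 2) * ‖x‖ := by
  rw [EuclideanSpace.norm_eq, ← Real.sqrt_mul (by positivity)]
  apply Real.abs_le_sqrt
  simp only [Fin.sum_univ_two, Real.norm_eq_abs, sq_abs]
  -- Cauchy–Schwarz in the form of Lagrange's identity: the defect is this square.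
  nlinarith [sq_nonneg (a * x 1 - b * x 0)]

/-- Up to a constant the difference is ±x₀ ± x₁, whose gradient has norm √2. It serves both as the
signed distance from the diagonal through the common corner and, for the other choice of sides, as
the coordinate along a diagonal. -/
theorem lipschitz_sub_sideDist {k l : Fin 4} (h : Adjacent k l) :
    LipschitzWith 1 fun x => (sideDist k x - sideDist l x) / √2 := by
  refine LipschitzWith.of_dist_le_mul fun x y => ?_
  have key : ∀ a b : ℝ, a ^ 2 = 1 → b ^ 2 = 1 →
      |(a * (x - y) 0 + b * (x - y) 1) / √2| ≤ ‖x - y‖ := by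
    intro a b ha hb
    have := abs_lincomb_le a b (x - y)
    rw [ha, hb, show (1 : ℝ) + 1 = 2 by norm_num] at this
    rw [abs_div, abs_of_pos (show (0 : ℝ) < √2 by positivity), div_le_iff₀ (by positivity)]
    linarith
  rw [NNReal.coe_one, one_mul, dist_eq_norm, dist_eq_norm, Real.norm_eq_abs]
  revert h
  fin_cases k <;> fin_cases l <;> intro h <;> first | exact absurd h (by decide) | skip
  all_goals simp only [sideDist]
  · convert key 1 (-1) (by norm_num) (by norm_num) using 2
    simp; ring
  · convert key 1 1 (by norm_num) (by norm_num) using 2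
    simp; ring
  · convert key (-1) 1 (by norm_num) (by norm_num) using 2
    simp; ring
  · convert key 1 1 (by norm_num) (by norm_num) using 2
    simp; ring
  · convert key (-1) (-1) (by norm_num) (by norm_num) using 2
    simp; ring
  · convert key (-1) 1 (by norm_num) (by norm_num) using 2
    simp; ring
  · convert key (-1) (-1) (by norm_num) (by norm_num) using 2
    simp; ring
  · convert key 1 (-1) (by norm_num) (by norm_num) using 2
    simp; ring

theorem abs_sub_sideDist_le (k : Fin 4) (x y : Plane) :
    |sideDist k x - sideDist k y| ≤ dist x y := by
  have h0 := abs_lincomb_le 1 0 (x - y)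
  have h1 := abs_lincomb_le 0 1 (x - y)
  simp at h0 h1
  rw [dist_eq_norm]
  fin_cases k <;> simp only [sideDist]
  · exact h0
  · exact h1
  · rwa [abs_sub_comm, sub_sub_sub_cancel_left, abs_sub_comm, abs_sub_comm]
  · rwa [abs_sub_comm, sub_sub_sub_cancel_left, abs_sub_comm, abs_sub_comm]

@[fun_prop]
theorem continuous_sideDist (k : Fin 4) : Continuous (sideDist k) := by
  fin_cases k <;> unfold sideDist <;> fun_prop

theorem mem_square_iff {x : Plane} : x ∈ square ↔ ∀ k, 0 ≤ sideDist k x := by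
  simp only [square, mem_ofPred_eq, mem_Icc, Fin.forall_fin_succ, sideDist]
  simp
  constructor
  · rintro ⟨⟨a, b⟩, c, d⟩
    exact ⟨a, c, b, d⟩
  · rintro ⟨a, c, b, d⟩
    exact ⟨⟨a, b⟩, c, d⟩

theorem sideDist_add_opposite (k : Fin 4) (x : Plane) :
    sideDist k x + sideDist (k + 2) x = 1 := by
  fin_cases k <;> simp [sideDist]

theorem isClosed_square : IsClosed square := by
  have : square = ⋂ k, {x | 0 ≤ sideDist k x} := by
    ext x; simp [mem_square_iff]
  rw [this]
  exact isClosed_iInter fun k => isClosed_le continuous_const (continuous_sideDist k)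

theorem measurableSet_square : MeasurableSet square := isClosed_square.measurableSet

theorem convex_square : Convex ℝ square := by
  intro x hx y hy a b ha hb hab i
  have := convex_Icc (0 : ℝ) 1 (hx i) (hy i) ha hb hab
  simpa using this

theorem mem_side_iff {k : Fin 4} {x : Plane} : x ∈ side k ↔ x ∈ square ∧ sideDist k x = 0 := by
  constructor
  · rintro ⟨t, ⟨h0, h1⟩, rfl⟩
    fin_cases k <;> simp [square, sidePoint, sideDist, Fin.forall_fin_two, h0, h1]
  · rintro ⟨hx, h⟩
    have h0 := hx 0
    have h1 := hx 1
    fin_cases k <;> simp only [sideDist] at h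
    · exact ⟨x 1, h1, by ext i; fin_cases i <;> simp [sidePoint, h]⟩
    · exact ⟨x 0, h0, by ext i; fin_cases i <;> simp [sidePoint, h]⟩
    · exact ⟨x 1, h1, by ext i; fin_cases i <;> simp [sidePoint]; linarith⟩
    · exact ⟨x 0, h0, by ext i; fin_cases i <;> simp [sidePoint]; linarith⟩

theorem sideDist_sidePoint_self (k : Fin 4) (t : ℝ) : sideDist k (sidePoint k t) = 0 := by
  fin_cases k <;> simp [sidePoint, sideDist]

theorem sideDist_pos_of_mem_openSide {k l : Fin 4} (hkl : l ≠ k) {x : Plane}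
    (hx : x ∈ openSide k) : 0 < sideDist l x := by
  obtain ⟨t, ⟨h0, h1⟩, rfl⟩ := hx
  revert hkl
  fin_cases k <;> fin_cases l <;> intro hkl <;> first | exact absurd rfl hkl | skip
  all_goals simp [sidePoint, sideDist, h0, h1]

theorem openSide_subset_side (k : Fin 4) : openSide k ⊆ side k :=
  image_mono Ioo_subset_Icc_self

theorem mem_openSide_iff {k : Fin 4} {x : Plane} :
    x ∈ openSide k ↔ x ∈ side k ∧ ∀ l ≠ k, x ∉ side l := by
  constructor
  · intro hx
    exact ⟨openSide_subset_side k hx, fun l hl h =>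
      (sideDist_pos_of_mem_openSide hl hx).ne' (mem_side_iff.1 h).2⟩
  · rintro ⟨⟨t, ⟨h0, h1⟩, rfl⟩, h⟩
    refine ⟨t, ⟨lt_of_le_of_ne h0 ?_, lt_of_le_of_ne h1 ?_⟩, rfl⟩ <;> rintro rfl
    · revert h
      fin_cases k <;> intro h
      · exact h 1 (by decide) ⟨0, by simp, by simp [sidePoint]⟩
      · exact h 0 (by decide) ⟨0, by simp, by simp [sidePoint]⟩
      · exact h 1 (by decide) ⟨1, by simp, by simp [sidePoint]⟩
      · exact h 0 (by decide) ⟨1, by simp, by simp [sidePoint]⟩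
    · revert h
      fin_cases k <;> intro h
      · exact h 3 (by decide) ⟨0, by simp, by simp [sidePoint]⟩
      · exact h 2 (by decide) ⟨0, by simp, by simp [sidePoint]⟩
      · exact h 3 (by decide) ⟨1, by simp, by simp [sidePoint]⟩
      · exact h 2 (by decide) ⟨1, by simp, by simp [sidePoint]⟩

theorem isClosed_side (k : Fin 4) : IsClosed (side k) := by
  have : side k = square ∩ {x | sideDist k x = 0} := by
    ext x; exact mem_side_iff
  rw [this]
  exact isClosed_square.inter (isClosed_eq (continuous_sideDist k) continuous_const)

theorem isClosed_region (I : Finset (Fin 4)) : IsClosed (region I) :=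
  I.finite_toSet.isClosed_biUnion fun k _ => isClosed_side k

theorem mem_region_iff {I : Finset (Fin 4)} {x : Plane} :
    x ∈ region I ↔ ∃ k ∈ I, x ∈ side k := by simp [region]

/-- A diagonal is the locus equidistant from two adjacent sides. The order of the difference makes
it negative on `AB` away from the corners, as `isHomologousSurface_of_affine` needs; `diagBC_eq`
does the same for `BC`. -/
theorem diagAB_eq : diagAB = {x | x ∈ square ∧ sideDist 0 x - sideDist 3 x = 0} := by
  ext x
  simp only [diagAB, segment_eq_image_lineMap, mem_image, mem_ofPred_eq]
  constructor
  · rintro ⟨t, ⟨h0, h1⟩, rfl⟩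
    simp [square, Fin.forall_fin_two, sideDist, AffineMap.lineMap_apply, h0, h1]
  · rintro ⟨h, h'⟩
    refine ⟨x 0, h 0, ?_⟩
    simp only [sideDist] at h'
    ext i; fin_cases i <;> simp [AffineMap.lineMap_apply]; linarith

theorem diagBC_eq : diagBC = {x | x ∈ square ∧ sideDist 1 x - sideDist 0 x = 0} := by
  ext x
  simp only [diagBC, segment_eq_image_lineMap, mem_image, mem_ofPred_eq]
  constructor
  · rintro ⟨t, ⟨h0, h1⟩, rfl⟩
    simp [square, Fin.forall_fin_two, sideDist, AffineMap.lineMap_apply, h0, h1]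
  · rintro ⟨h, h'⟩
    refine ⟨x 0, h 0, ?_⟩
    simp only [sideDist] at h'
    ext i; fin_cases i <;> simp [AffineMap.lineMap_apply]; linarith

/-! ## Minimal surfaces -/

/-- A surface homologous to `A_I` meets every segment that joins `A_I` to its complement. -/
theorem IsHomologousSurface.inter_segment_nonempty {I : Finset (Fin 4)} {m : Set Plane}
    (hm : IsHomologousSurface I m) {p q : Plane} (hp : p ∈ region I \ region Iᶜ)
    (hq : q ∈ region Iᶜ \ region I) : (segment ℝ p q ∩ m).Nonempty := by
  obtain ⟨r, -, h1, h2, rfl⟩ := hm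
  have hsq : ∀ J : Finset (Fin 4), ∀ z ∈ region J, z ∈ square := by
    intro J z hz
    obtain ⟨k, -, hk⟩ := mem_region_iff.1 hz
    exact (mem_side_iff.1 hk).1
  have hps := hsq _ p hp.1
  have hqs := hsq _ q hq.1
  refine isPreconnected_closed_iff.1 (convex_segment p q).isPreconnected _ _
    isClosed_closure isClosed_closure ?_ ⟨p, left_mem_segment ℝ p q, ?_⟩
    ⟨q, right_mem_segment ℝ p q, ?_⟩
  · intro z hz
    have hz := convex_square.segment_subset hps hqs hz
    by_cases h : z ∈ r
    · exact Or.inl (subset_closure h)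
    · exact Or.inr (subset_closure ⟨hz, h⟩)
  · exact subset_closure (mem_of_mem_nhdsWithin hps (h1 p hp))
  · exact subset_closure (mem_of_mem_nhdsWithin hqs (h2 q hq))

/-- A calibration by projection: every level segment of `f` between the two regions meets `m`, so
`f` maps `m` onto at least the interval, and a 1-Lipschitz map does not increase length. -/
theorem IsHomologousSurface.le_hausdorffMeasure {I : Finset (Fin 4)} {m : Set Plane}
    (hm : IsHomologousSurface I m) {f : Plane → ℝ} (hf : LipschitzWith 1 f) {a b : ℝ}
    (h : ∀ s ∈ Ioo a b, ∃ p ∈ region I \ region Iᶜ, ∃ q ∈ region Iᶜ \ region I,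
      ∀ z ∈ segment ℝ p q, f z = s) :
    ENNReal.ofReal (b - a) ≤ μH[1] m := by
  have hsub : Ioo a b ⊆ f '' m := by
    intro s hs
    obtain ⟨p, hp, q, hq, hpq⟩ := h s hs
    obtain ⟨z, hz, hzm⟩ := hm.inter_segment_nonempty hp hq
    exact ⟨z, hzm, hpq z hz⟩
  calc ENNReal.ofReal (b - a) = volume (Ioo a b) := Real.volume_Ioo.symm
    _ ≤ volume (f '' m) := measure_mono hsub
    _ = μH[1] (f '' m) := by rw [hausdorffMeasure_real]
    _ ≤ μH[1] m := by simpa using hf.hausdorffMeasure_image_le zero_le_one m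

/-- The part of the square where an affine function is nonpositive is bounded by the part where
it vanishes. -/
theorem isHomologousSurface_of_affine {I : Finset (Fin 4)} {l : Plane → ℝ} (hl : Continuous l)
    (haff : ∀ (x y : Plane) (t : ℝ), l (AffineMap.lineMap x y t) = (1 - t) * l x + t * l y)
    (hneg : ∀ x ∈ region I \ region Iᶜ, l x < 0) (hpos : ∀ x ∈ region Iᶜ \ region I, 0 < l x)
    {c : Plane} (hc : c ∈ square) (hlc : 0 < l c) :
    IsHomologousSurface I {x | x ∈ square ∧ l x = 0} := by
  refine ⟨{x | x ∈ square ∧ l x ≤ 0}, fun x hx => hx.1, ?_, ?_, ?_⟩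
  · intro x hx
    filter_upwards [self_mem_nhdsWithin,
      mem_nhdsWithin_of_mem_nhds ((isOpen_lt hl continuous_const).mem_nhds (hneg x hx))]
      with y hy hy'
    exact ⟨hy, le_of_lt hy'⟩
  · intro x hx
    filter_upwards [self_mem_nhdsWithin,
      mem_nhdsWithin_of_mem_nhds ((isOpen_lt continuous_const hl).mem_nhds (hpos x hx))]
      with y hy hy'
    exact ⟨hy, fun h => not_lt_of_ge h.2 hy'⟩
  · have hcl : IsClosed {x | x ∈ square ∧ l x ≤ 0} :=
      isClosed_square.inter (isClosed_le hl continuous_const)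
    rw [hcl.closure_eq]
    ext x
    constructor
    · rintro ⟨hx, h0⟩
      refine ⟨⟨hx, h0.le⟩, ?_⟩
      -- A zero of `l` is the limit of points on the segment towards `c`, where `l` is positive;
      -- this rules out that `l` is nonpositive near that zero.
      have ht : Tendsto (fun t : ℝ => AffineMap.lineMap x c t) (𝓝[>] 0) (𝓝 x) := by
        have : Continuous fun t : ℝ => (AffineMap.lineMap x c t : Plane) :=
          AffineMap.lineMap_continuous
        simpa using (this.tendsto 0).mono_left nhdsWithin_le_nhds
      refine mem_closure_of_tendsto ht ?_
      filter_upwards [Ioo_mem_nhdsGT (zero_lt_one (α := ℝ))] with t ht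
      refine ⟨convex_square.lineMap_mem hx hc ⟨ht.1.le, ht.2.le⟩, fun h => ?_⟩
      have := h.2
      rw [haff, h0] at this
      nlinarith [mul_pos ht.1 hlc]
    · rintro ⟨⟨hx, h0⟩, h⟩
      refine ⟨hx, le_antisymm h0 ?_⟩
      have : closure (square \ {x | x ∈ square ∧ l x ≤ 0}) ⊆ {x | 0 ≤ l x} := by
        refine closure_minimal ?_ (isClosed_le continuous_const hl)
        rintro y ⟨hy, hy'⟩
        by_contra h
        exact hy' ⟨hy, (not_le.1 h).le⟩
      exact this h

theorem sideDist_lineMap (k : Fin 4) (x y : Plane) (t : ℝ) :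
    sideDist k (AffineMap.lineMap x y t) = (1 - t) * sideDist k x + t * sideDist k y := by
  fin_cases k <;> simp [sideDist, AffineMap.lineMap_apply] <;> ring

theorem one_sub_eq_zero_iff {a : ℝ} : 1 - a = 0 ↔ a = 1 := by
  rw [sub_eq_zero, eq_comm]

theorem mem_region_AB {x : Plane} :
    x ∈ region AB ↔ x ∈ square ∧ (x 0 = 0 ∨ x 1 = 0) := by
  simp [mem_region_iff, AB, mem_side_iff, sideDist]
  tauto

theorem mem_region_compl_AB {x : Plane} :
    x ∈ region ABᶜ ↔ x ∈ square ∧ (x 0 = 1 ∨ x 1 = 1) := by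
  rw [show ABᶜ = {2, 3} by decide]
  simp [mem_region_iff, mem_side_iff, sideDist, one_sub_eq_zero_iff]
  tauto

theorem mem_region_BC {x : Plane} :
    x ∈ region BC ↔ x ∈ square ∧ (x 1 = 0 ∨ x 0 = 1) := by
  simp [mem_region_iff, BC, mem_side_iff, sideDist, one_sub_eq_zero_iff]
  tauto

theorem mem_region_compl_BC {x : Plane} :
    x ∈ region BCᶜ ↔ x ∈ square ∧ (x 0 = 0 ∨ x 1 = 1) := by
  rw [show BCᶜ = {0, 3} by decide]
  simp [mem_region_iff, mem_side_iff, sideDist, one_sub_eq_zero_iff]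
  tauto

theorem isHomologousSurface_diagAB : IsHomologousSurface AB diagAB := by
  rw [diagAB_eq]
  refine isHomologousSurface_of_affine (c := !₂[1, 1]) (by fun_prop) ?_ ?_ ?_ ?_ ?_
  · intro x y t
    simp only [sideDist_lineMap]; ring
  · rintro x ⟨h, h'⟩
    rw [mem_region_AB] at h
    rw [mem_region_compl_AB] at h'
    have h0 := h.1 0
    have h1 := h.1 1
    simp only [h.1, true_and, not_or] at h'
    have h0' := lt_of_le_of_ne h0.2 h'.1
    have h1' := lt_of_le_of_ne h1.2 h'.2
    simp only [sideDist]
    rcases h.2 with h | h <;> linarith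
  · rintro x ⟨h', h⟩
    rw [mem_region_AB] at h
    rw [mem_region_compl_AB] at h'
    have h0 := h'.1 0
    have h1 := h'.1 1
    simp only [h'.1, true_and, not_or] at h
    have h0' := lt_of_le_of_ne h0.1 (Ne.symm h.1)
    have h1' := lt_of_le_of_ne h1.1 (Ne.symm h.2)
    simp only [sideDist]
    rcases h'.2 with h | h <;> linarith
  · simp [square, Fin.forall_fin_two]
  · simp [sideDist]

theorem isHomologousSurface_diagBC : IsHomologousSurface BC diagBC := by
  rw [diagBC_eq]
  refine isHomologousSurface_of_affine (c := !₂[0, 1]) (by fun_prop) ?_ ?_ ?_ ?_ ?_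
  · intro x y t
    simp only [sideDist_lineMap]; ring
  · rintro x ⟨h, h'⟩
    rw [mem_region_BC] at h
    rw [mem_region_compl_BC] at h'
    have h0 := h.1 0
    have h1 := h.1 1
    simp only [h.1, true_and, not_or] at h'
    have h0' := lt_of_le_of_ne h0.1 (Ne.symm h'.1)
    have h1' := lt_of_le_of_ne h1.2 h'.2
    simp only [sideDist]
    rcases h.2 with h | h <;> linarith
  · rintro x ⟨h', h⟩
    rw [mem_region_BC] at h
    rw [mem_region_compl_BC] at h'
    have h0 := h'.1 0
    have h1 := h'.1 1
    simp only [h'.1, true_and, not_or] at h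
    have h0' := lt_of_le_of_ne h0.2 h.2
    have h1' := lt_of_le_of_ne h1.1 (Ne.symm h.1)
    simp only [sideDist]
    rcases h'.2 with h | h <;> linarith
  · simp [square, Fin.forall_fin_two]
  · simp [sideDist]

theorem hausdorffMeasure_diagAB : μH[1] diagAB = ENNReal.ofReal √2 := by
  rw [diagAB, hausdorffMeasure_segment, edist_dist, EuclideanSpace.dist_eq]
  norm_num

theorem hausdorffMeasure_diagBC : μH[1] diagBC = ENNReal.ofReal √2 := by
  rw [diagBC, hausdorffMeasure_segment, edist_dist, EuclideanSpace.dist_eq]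
  norm_num

theorem mem_Ioo_of_div_sqrt_two {s : ℝ} (hs : s ∈ Ioo (-(√2 / 2)) (√2 / 2)) :
    s * √2 ∈ Ioo (-1 : ℝ) 1 := by
  have h2 : √2 * √2 = 2 := Real.mul_self_sqrt (by norm_num)
  have hp : (0 : ℝ) < √2 := by positivity
  constructor <;> nlinarith [hs.1, hs.2]

theorem S_AB : S AB = ENNReal.ofReal √2 := by
  refine le_antisymm ((iInf₂_le _ isHomologousSurface_diagAB).trans
    hausdorffMeasure_diagAB.le) (le_iInf₂ fun m hm => ?_)
  rw [show √2 = √2 / 2 - -(√2 / 2) by ring]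
  refine hm.le_hausdorffMeasure (lipschitz_sub_sideDist (k := 0) (l := 1) (by decide))
    fun s hs => ?_
  have hs' := mem_Ioo_of_div_sqrt_two hs
  set d := s * √2 with hd
  -- The partner of `p` is its mirror image in the diagonal `diagAB`, so the segment is
  -- perpendicular to that diagonal and the coordinate x₀ - x₁ is constant on it.
  have key : ∀ p : Plane, p 0 - p 1 = d → p ∈ square → (p 0 = 0 ∨ p 1 = 0) →
      ∃ p ∈ region AB \ region ABᶜ, ∃ q ∈ region ABᶜ \ region AB,
      ∀ z ∈ segment ℝ p q, (sideDist 0 z - sideDist 1 z) / √2 = s := by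
    intro p hp hps hp0
    have h0 := hps 0
    have h1 := hps 1
    have hlt : p 0 + p 1 < 1 := by rcases hp0 with h | h <;> linarith [hs'.1, hs'.2]
    have hqs : (!₂[1 - p 1, 1 - p 0] : Plane) ∈ square := by
      simpa [square, Fin.forall_fin_two] using ⟨⟨h1.2, h1.1⟩, h0.2, h0.1⟩
    refine ⟨p, ⟨mem_region_AB.2 ⟨hps, hp0⟩, ?_⟩, !₂[1 - p 1, 1 - p 0],
      ⟨mem_region_compl_AB.2 ⟨hqs, ?_⟩, ?_⟩, ?_⟩
    · rw [mem_region_compl_AB]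
      rintro ⟨-, h | h⟩ <;> linarith [h0.1, h1.1]
    · simpa using hp0.symm
    · rw [mem_region_AB]
      simp only [hqs, true_and]
      simp
      constructor <;> intro h <;> linarith [h0.1, h1.1]
    · rw [segment_eq_image_lineMap]
      rintro _ ⟨t, -, rfl⟩
      rw [sideDist_lineMap, sideDist_lineMap]
      simp only [sideDist]
      simp
      rw [div_eq_iff (by positivity), ← hd, ← hp]
      ring
  rcases le_total 0 d with h | h
  · exact key !₂[d, 0] (by simp) (by simp [square, Fin.forall_fin_two, h, hs'.2.le]) (by simp)
  · exact key !₂[0, -d] (by simp)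
      (by simp [square, Fin.forall_fin_two, h]; linarith [hs'.1]) (by simp)

theorem S_BC : S BC = ENNReal.ofReal √2 := by
  refine le_antisymm ((iInf₂_le _ isHomologousSurface_diagBC).trans
    hausdorffMeasure_diagBC.le) (le_iInf₂ fun m hm => ?_)
  rw [show √2 = √2 / 2 - -(√2 / 2) by ring]
  refine hm.le_hausdorffMeasure (lipschitz_sub_sideDist (k := 0) (l := 3) (by decide))
    fun s hs => ?_
  have hs' := mem_Ioo_of_div_sqrt_two hs
  set d := s * √2 with hd
  -- Reflection in `diagBC` swaps the coordinates and preserves their sum.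
  have key : ∀ p : Plane, p 0 + p 1 - 1 = d → p ∈ square → (p 1 = 0 ∨ p 0 = 1) →
      ∃ p ∈ region BC \ region BCᶜ, ∃ q ∈ region BCᶜ \ region BC,
      ∀ z ∈ segment ℝ p q, (sideDist 0 z - sideDist 3 z) / √2 = s := by
    intro p hp hps hp0
    have h0 := hps 0
    have h1 := hps 1
    have hlt : p 1 < p 0 := by rcases hp0 with h | h <;> linarith [hs'.1, hs'.2]
    have hqs : (!₂[p 1, p 0] : Plane) ∈ square := by
      simpa [square, Fin.forall_fin_two] using ⟨h1, h0⟩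
    refine ⟨p, ⟨mem_region_BC.2 ⟨hps, hp0⟩, ?_⟩, !₂[p 1, p 0],
      ⟨mem_region_compl_BC.2 ⟨hqs, ?_⟩, ?_⟩, ?_⟩
    · rw [mem_region_compl_BC]
      rintro ⟨-, h | h⟩ <;> linarith [h0.2, h1.1]
    · simpa using hp0
    · rw [mem_region_BC]
      simp only [hqs, true_and]
      simp
      constructor <;> intro h <;> linarith [h0.2, h1.1]
    · rw [segment_eq_image_lineMap]
      rintro _ ⟨t, -, rfl⟩
      rw [sideDist_lineMap, sideDist_lineMap]
      simp only [sideDist]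
      simp
      rw [div_eq_iff (by positivity), ← hd, ← hp]
      ring
  rcases le_total 0 d with h | h
  · exact key !₂[1, d] (by simp) (by simp [square, Fin.forall_fin_two, h, hs'.2.le]) (by simp)
  · exact key !₂[1 + d, 0] (by simp)
      (by simp [square, Fin.forall_fin_two, h]; linarith [hs'.1]) (by simp)

/-! ## Integrals over the square -/

/-- The point of the plane with given coordinates. -/
noncomputable def planePoint : ℝ × ℝ ≃ᵐ Plane :=
  (MeasurableEquiv.finTwoArrow (α := ℝ)).symm.trans (MeasurableEquiv.toLp 2 (Fin 2 → ℝ))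

theorem planePoint_apply (p : ℝ × ℝ) : planePoint p = !₂[p.1, p.2] := by
  ext i; fin_cases i <;> rfl

theorem measurePreserving_planePoint : MeasurePreserving planePoint :=
  (PiLp.volume_preserving_toLp (Fin 2)).comp
    ((volume_preserving_finTwoArrow ℝ).symm)

theorem planePoint_preimage_square : planePoint ⁻¹' square = Icc 0 1 ×ˢ Icc 0 1 := by
  ext p
  simp only [planePoint_apply, square, mem_preimage, mem_ofPred_eq, Fin.forall_fin_two, mem_prod]
  rfl

theorem isCompact_square : IsCompact square := by
  have : square = (WithLp.toLp 2) '' (Set.pi univ fun _ : Fin 2 => Icc (0 : ℝ) 1) := by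
    ext x
    constructor
    · intro h
      exact ⟨x.ofLp, fun i _ => h i, rfl⟩
    · rintro ⟨y, hy, rfl⟩ i
      exact hy i trivial
  rw [this]
  exact (isCompact_univ_pi fun _ => isCompact_Icc).image (PiLp.continuous_toLp 2 _)

theorem setIntegral_square {f : Plane → ℝ} (hf : IntegrableOn f square) :
    ∫ x in square, f x = ∫ x in Icc (0 : ℝ) 1, ∫ y in Icc (0 : ℝ) 1, f !₂[x, y] := by
  have h := measurePreserving_planePoint.setIntegral_preimage_emb
    planePoint.measurableEmbedding f square
  rw [← h, planePoint_preimage_square, Measure.volume_eq_prod, setIntegral_prod]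
  · simp [planePoint_apply]
  · have := (measurePreserving_planePoint.integrableOn_comp_preimage
      planePoint.measurableEmbedding (f := f) (s := square)).2 hf
    rwa [planePoint_preimage_square] at this

theorem volume_square : volume square = 1 := by
  rw [← measurePreserving_planePoint.measure_preimage measurableSet_square.nullMeasurableSet,
    planePoint_preimage_square, Measure.volume_eq_prod, Measure.prod_prod]
  simp

/-- Substitution y = √2 ε u + c. The factor √2 appears because the vertical offset from a line of
slope ±1 is √2 times the distance; it later becomes the arc length element √2 dx of the diagonal. -/
theorem integral_smear_substitution {ε : ℝ} (hε : 0 < ε) (v k : ℝ → ℝ) (c : ℝ) :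
    ∫ y in Icc (0 : ℝ) 1, v y * (k ((y - c) / (√2 * ε)) / ε) =
      √2 * ∫ u, (Icc (0 : ℝ) 1).indicator v (√2 * ε * u + c) * k u := by
  have hs : 0 < √2 * ε := by positivity
  rw [← integral_indicator measurableSet_Icc]
  have h1 := integral_add_right_eq_self (μ := volume)
    (fun y => (Icc (0 : ℝ) 1).indicator (fun y => v y * (k ((y - c) / (√2 * ε)) / ε)) y) c
  have h2 := Measure.integral_comp_mul_left
    (fun y => (Icc (0 : ℝ) 1).indicator (fun y => v y * (k ((y - c) / (√2 * ε)) / ε)) (y + c))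
    (√2 * ε)
  rw [h1, abs_of_pos (by positivity), smul_eq_mul] at h2
  rw [inv_mul_eq_div, eq_div_iff hs.ne'] at h2
  rw [← h2, mul_comm, mul_assoc, ← integral_const_mul]
  congr 1
  congr 1
  ext u
  by_cases h : √2 * ε * u + c ∈ Icc (0 : ℝ) 1
  · rw [indicator_of_mem h, indicator_of_mem h]
    rw [add_sub_cancel_right, mul_div_cancel_left₀ _ hs.ne']
    field_simp
  · rw [indicator_of_notMem h, indicator_of_notMem h]; simp

/-- A bounded kernel of width `ε` concentrated along a graph `y = d x` tends to a multiple of the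
line measure. -/
theorem tendsto_integral_smear {w : Plane → ℝ} (hw : Continuous w) {k d : ℝ → ℝ}
    (hk : Continuous k) (hkc : HasCompactSupport k) (hd : Continuous d)
    (hmaps : ∀ x ∈ Ioo (0 : ℝ) 1, d x ∈ Ioo (0 : ℝ) 1) :
    Tendsto (fun ε => ∫ x in square, w x * (k ((x 1 - d (x 0)) / (√2 * ε)) / ε)) (𝓝[>] 0)
      (𝓝 (∫ x in Icc (0 : ℝ) 1, √2 * (w !₂[x, d x] * ∫ u, k u))) := by
  obtain ⟨C, hC⟩ := isCompact_square.exists_bound_of_continuousOn hw.continuousOn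
  have hC0 : 0 ≤ C := (norm_nonneg _).trans (hC 0 (by simp [square]))
  have hki : Integrable k := hk.integrable_of_hasCompactSupport hkc
  have hint : ∀ ε : ℝ, IntegrableOn
      (fun x : Plane => w x * (k ((x 1 - d (x 0)) / (√2 * ε)) / ε)) square := fun ε =>
    (Continuous.continuousOn (by fun_prop)).integrableOn_compact isCompact_square
  have hbound : ∀ x ∈ Icc (0 : ℝ) 1, ∀ ε u : ℝ,
      ‖(Icc (0 : ℝ) 1).indicator (fun y => w !₂[x, y]) (√2 * ε * u + d x) * k u‖
        ≤ C * ‖k u‖ := by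
    intro x hx ε u
    rw [norm_mul]
    refine mul_le_mul_of_nonneg_right ?_ (norm_nonneg _)
    by_cases h : √2 * ε * u + d x ∈ Icc (0 : ℝ) 1
    · rw [indicator_of_mem h]
      exact hC _ (by simpa [square, Fin.forall_fin_two] using ⟨hx, h⟩)
    · rw [indicator_of_notMem h]; simpa
  have hinner : ∀ ε > 0, ∫ x in square, w x * (k ((x 1 - d (x 0)) / (√2 * ε)) / ε) =
      ∫ x in Icc (0 : ℝ) 1, √2 * ∫ u,
        (Icc (0 : ℝ) 1).indicator (fun y => w !₂[x, y]) (√2 * ε * u + d x) * k u := by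
    intro ε hε
    rw [setIntegral_square (hint ε)]
    refine setIntegral_congr_fun measurableSet_Icc fun x _ => ?_
    exact integral_smear_substitution hε (fun y => w !₂[x, y]) k (d x)
  -- Dominated convergence is used twice, in x here and in u below, with the majorant C‖k u‖ that
  -- does not depend on ε or x.
  refine (tendsto_integral_filter_of_dominated_convergence (μ := volume.restrict (Icc 0 1))
    (F := fun ε x => √2 * ∫ u,
        (Icc (0 : ℝ) 1).indicator (fun y => w !₂[x, y]) (√2 * ε * u + d x) * k u)
    (fun _ => √2 * ∫ u, C * ‖k u‖) ?_ ?_ ?_ ?_).congr' ?_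
  · filter_upwards [self_mem_nhdsWithin] with ε hε
    have h1 := (measurePreserving_planePoint.integrableOn_comp_preimage
      planePoint.measurableEmbedding).2 (hint ε)
    rw [planePoint_preimage_square, IntegrableOn, Measure.volume_eq_prod,
      ← Measure.prod_restrict] at h1
    refine h1.integral_prod_left.aestronglyMeasurable.congr (ae_of_all _ fun x => ?_)
    simp only [Function.comp_apply, planePoint_apply]
    exact integral_smear_substitution hε (fun y => w !₂[x, y]) k (d x)
  · refine Eventually.of_forall fun ε => ?_
    filter_upwards [ae_restrict_mem measurableSet_Icc] with x hx
    rw [norm_mul, Real.norm_of_nonneg (Real.sqrt_nonneg 2)]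
    refine mul_le_mul_of_nonneg_left ?_ (Real.sqrt_nonneg 2)
    exact norm_integral_le_of_norm_le (hki.norm.const_mul C) (ae_of_all _ (hbound x hx ε))
  · exact integrable_const _
  -- Over the open interval the graph stays off the bottom and top sides, so for small ε the cut-off
  -- to [0,1] is inactive at each fixed u. The two endpoints are null.
  · rw [← restrict_Ioo_eq_restrict_Icc]
    filter_upwards [ae_restrict_mem measurableSet_Ioo] with x hx
    refine Tendsto.const_mul _ ?_
    rw [← integral_const_mul]
    refine tendsto_integral_filter_of_dominated_convergence (fun u => C * ‖k u‖) ?_ ?_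
      (hki.norm.const_mul C) ?_
    · refine Eventually.of_forall fun ε => ?_
      have : Measurable (fun y => w !₂[x, y]) := by
        refine Continuous.measurable (hw.comp ?_)
        fun_prop
      exact (((this.indicator measurableSet_Icc).comp (by fun_prop)).mul
        hk.measurable).aestronglyMeasurable
    · exact Eventually.of_forall fun ε => ae_of_all _ (hbound x (Ioo_subset_Icc_self hx) ε)
    · refine ae_of_all _ fun u => Tendsto.mul_const _ ?_
      have ht : Tendsto (fun ε : ℝ => √2 * ε * u + d x) (𝓝[>] 0) (𝓝 (d x)) := by
        have : Continuous fun ε : ℝ => √2 * ε * u + d x := by fun_prop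
        simpa using (this.tendsto 0).mono_left nhdsWithin_le_nhds
      have hw' : Continuous fun y : ℝ => w !₂[x, y] := hw.comp (by fun_prop)
      refine ((hw'.tendsto (d x)).comp ht).congr' ?_
      filter_upwards [ht.eventually (Icc_mem_nhds (hmaps x hx).1 (hmaps x hx).2)] with ε hε
      exact (indicator_of_mem (mem_Icc.2 hε) fun y => w !₂[x, y]).symm
  · filter_upwards [self_mem_nhdsWithin] with ε hε using (hinner ε hε).symm

theorem integral_max_one_sub_four_mul :
    ∫ x in Icc (0 : ℝ) 1, max 0 (1 - 4 * x) = 1 / 8 := by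
  have hc : Continuous fun x : ℝ => max 0 (1 - 4 * x) := by fun_prop
  rw [integral_Icc_eq_integral_Ioc, ← intervalIntegral.integral_of_le zero_le_one,
    ← intervalIntegral.integral_add_adjacent_intervals (b := 1 / 4)
      (hc.intervalIntegrable _ _) (hc.intervalIntegrable _ _),
    intervalIntegral.integral_congr (g := fun x => 1 - 4 * x),
    intervalIntegral.integral_congr (a := 1 / 4) (g := fun _ => 0)]
  · rw [intervalIntegral.integral_sub (by simp)
      (Continuous.intervalIntegrable (by fun_prop) _ _), intervalIntegral.integral_const_mul]
    simp
    norm_num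
  · intro x hx
    rw [uIcc_of_le (by norm_num)] at hx
    exact max_eq_left (by linarith [hx.1])
  · intro x hx
    rw [uIcc_of_le (by norm_num)] at hx
    exact max_eq_right (by linarith [hx.2])

theorem integral_Icc_comp_one_sub (f : ℝ → ℝ) :
    ∫ x in Icc (0 : ℝ) 1, f (1 - x) = ∫ x in Icc (0 : ℝ) 1, f x := by
  rw [integral_Icc_eq_integral_Ioc, ← intervalIntegral.integral_of_le zero_le_one,
    integral_Icc_eq_integral_Ioc, ← intervalIntegral.integral_of_le zero_le_one,
    intervalIntegral.integral_comp_sub_left]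
  simp

/-! ## Distances to the diagonals and to the corners -/

theorem dist_planePoint (x : Plane) (a b : ℝ) :
    dist x !₂[a, b] = √((x 0 - a) ^ 2 + (x 1 - b) ^ 2) := by
  rw [EuclideanSpace.dist_eq]
  simp [Fin.sum_univ_two, Real.dist_eq, sq_abs]

/-- The distance from the common zero set, in the square, of the difference of the distances
from two adjacent sides. -/
theorem infDist_eq_of_adjacent {k l : Fin 4} (h : Adjacent k l) {m : Set Plane}
    (hm : ∀ y ∈ m, sideDist k y = sideDist l y) {x : Plane}
    (hx : ∃ y ∈ m, dist x y ≤ |sideDist k x - sideDist l x| / √2) :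
    Metric.infDist x m = |sideDist k x - sideDist l x| / √2 := by
  obtain ⟨y, hy, hxy⟩ := hx
  refine le_antisymm ((Metric.infDist_le_dist_of_mem hy).trans hxy) ?_
  rw [Metric.le_infDist ⟨y, hy⟩]
  intro z hz
  have := (lipschitz_sub_sideDist h).dist_le_mul x z
  rw [NNReal.coe_one, one_mul, Real.dist_eq, hm z hz, sub_self, zero_div, sub_zero,
    abs_div, abs_of_pos (show (0 : ℝ) < √2 by positivity)] at this
  exact this

theorem sqrt_half_sq (a : ℝ) : √((a / 2) ^ 2 + (a / 2) ^ 2) ≤ |a| / √2 := by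
  apply Real.sqrt_le_iff.2 ⟨by positivity, ?_⟩
  rw [div_pow |a|, sq_abs, Real.sq_sqrt (by norm_num)]
  linarith [sq_nonneg a]

theorem infDist_diagAB {x : Plane} (hx : x ∈ square) :
    Metric.infDist x diagAB = |sideDist 0 x - sideDist 3 x| / √2 := by
  refine infDist_eq_of_adjacent (by decide) ?_ ?_
  · rw [diagAB_eq]
    exact fun y hy => sub_eq_zero.1 hy.2
  · have h0 := hx 0
    have h1 := hx 1
    -- The foot of the perpendicular from `x`.
    refine ⟨!₂[(1 + x 0 - x 1) / 2, (1 + x 1 - x 0) / 2], ?_, ?_⟩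
    · rw [diagAB_eq]
      simp [square, sideDist, Fin.forall_fin_two]
      refine ⟨⟨⟨?_, ?_⟩, ?_, ?_⟩, ?_⟩ <;> linarith [h0.1, h0.2, h1.1, h1.2]
    · rw [dist_planePoint]
      convert sqrt_half_sq (sideDist 0 x - sideDist 3 x) using 4 <;> simp only [sideDist] <;> ring

theorem infDist_diagBC {x : Plane} (hx : x ∈ square) :
    Metric.infDist x diagBC = |sideDist 1 x - sideDist 0 x| / √2 := by
  refine infDist_eq_of_adjacent (by decide) ?_ ?_
  · rw [diagBC_eq]
    exact fun y hy => sub_eq_zero.1 hy.2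
  · have h0 := hx 0
    have h1 := hx 1
    refine ⟨!₂[(x 0 + x 1) / 2, (x 0 + x 1) / 2], ?_, ?_⟩
    · rw [diagBC_eq]
      simp [square, sideDist, Fin.forall_fin_two]
      refine ⟨?_, ?_⟩ <;> linarith [h0.1, h0.2, h1.1, h1.2]
    · rw [dist_planePoint]
      convert sqrt_half_sq (sideDist 1 x - sideDist 0 x) using 2
      simp only [sideDist]; ring

/-- It does not matter which diagonal passes through the common corner: `dualFun` carries both tents
with the same weight, and the unwanted one is nonnegative. -/
theorem diag_infDist_of_adjacent {k l : Fin 4} (h : Adjacent k l) {x : Plane} (hx : x ∈ square) :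
    Metric.infDist x diagAB = |sideDist k x - sideDist l x| / √2 ∨
      Metric.infDist x diagBC = |sideDist k x - sideDist l x| / √2 := by
  rw [infDist_diagAB hx, infDist_diagBC hx]
  revert h
  fin_cases k <;> fin_cases l <;> intro h <;> first | exact absurd h (by decide) | skip
  all_goals simp only [sideDist]
  · right; rw [abs_sub_comm]
  · left; trivial
  · right; trivial
  · left; congr 2; ring
  · left; rw [abs_sub_comm]; congr 2; ring
  · right; congr 2; ring
  · left; rw [abs_sub_comm]
  · right; rw [abs_sub_comm]; congr 2; ring

/-- The right side is √2 max(a, b). It is kept as a sum so that the second term is the distance from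
the diagonal, which is small where the tent lives. -/
theorem sqrt_sq_add_sq_le {a b : ℝ} (ha : 0 ≤ a) (hb : 0 ≤ b) :
    √(a ^ 2 + b ^ 2) ≤ (a + b) / √2 + |a - b| / √2 := by
  have h2 : √2 ^ 2 = 2 := Real.sq_sqrt (by norm_num)
  rw [← add_div]
  apply Real.sqrt_le_iff.2 ⟨by positivity, ?_⟩
  rw [div_pow, h2]
  nlinarith [sq_abs (a - b), mul_nonneg (add_nonneg ha hb) (abs_nonneg (a - b))]

theorem cornerDist_le {k l : Fin 4} (h : Adjacent k l) {x : Plane} (hx : x ∈ square) :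
    cornerDist x ≤
      (sideDist k x + sideDist l x) / √2 + |sideDist k x - sideDist l x| / √2 := by
  have hk := mem_square_iff.1 hx k
  have hl := mem_square_iff.1 hx l
  refine le_trans ?_ (sqrt_sq_add_sq_le hk hl)
  have key : ∀ a b : ℝ, (!₂[a, b] : Plane) ∈
      ({!₂[0, 0], !₂[1, 0], !₂[0, 1], !₂[1, 1]} : Set Plane) →
      (x 0 - a) ^ 2 + (x 1 - b) ^ 2 = sideDist k x ^ 2 + sideDist l x ^ 2 →
      cornerDist x ≤ √(sideDist k x ^ 2 + sideDist l x ^ 2) := by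
    intro a b hab heq
    rw [← heq, ← dist_planePoint]
    exact Metric.infDist_le_dist_of_mem hab
  clear hk hl
  revert h key
  fin_cases k <;> fin_cases l <;> intro h <;> first | exact absurd h (by decide) | skip
  all_goals simp only [sideDist]; intro key
  · exact key 0 0 (by simp) (by ring)
  · exact key 0 1 (by simp) (by ring)
  · exact key 0 0 (by simp) (by ring)
  · exact key 1 0 (by simp) (by ring)
  · exact key 1 0 (by simp) (by ring)
  · exact key 1 1 (by simp) (by ring)
  · exact key 0 1 (by simp) (by ring)
  · exact key 1 1 (by simp) (by ring)

/-! ### Continuity, sign and normalization of the smeared delta functions -/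

@[fun_prop]
theorem continuous_diagWeight : Continuous diagWeight := by
  have : Continuous cornerDist := Metric.continuous_infDist_pt _
  unfold diagWeight
  fun_prop

theorem diagWeight_nonneg (x : Plane) : 0 ≤ diagWeight x := le_max_left _ _

theorem tent_nonneg {ε : ℝ} (hε : 0 < ε) (s : ℝ) : 0 ≤ tent ε s :=
  div_nonneg (le_max_left _ _) hε.le

theorem tent_eq_zero {ε s : ℝ} (hε : 0 < ε) (h : ε ≤ s) : tent ε s = 0 := by
  rw [tent, max_eq_left, zero_div]
  rw [sub_nonpos, one_le_div hε]
  exact h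

@[fun_prop]
theorem continuous_tent (ε : ℝ) : Continuous (tent ε) := by
  unfold tent
  fun_prop

theorem continuous_dualFun (ε : ℝ) : Continuous (dualFun ε) := by
  have h1 : Continuous fun x : Plane => Metric.infDist x diagAB := Metric.continuous_infDist_pt _
  have h2 : Continuous fun x : Plane => Metric.infDist x diagBC := Metric.continuous_infDist_pt _
  unfold dualFun
  fun_prop

theorem two_le_dualFun {ε : ℝ} (hε : 0 < ε) (x : Plane) : 2 ≤ dualFun ε x :=
  le_add_of_nonneg_right (mul_nonneg (diagWeight_nonneg x)
    (add_nonneg (tent_nonneg hε _) (tent_nonneg hε _)))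

/-- The profile of `tent`. -/
noncomputable def tentProfile (u : ℝ) : ℝ := max 0 (1 - |u|)

theorem tent_eq_tentProfile {ε : ℝ} (hε : 0 < ε) (z : ℝ) :
    tent ε (|z| / √2) = tentProfile (z / (√2 * ε)) / ε := by
  rw [tent, tentProfile, abs_div, abs_of_pos (show 0 < √2 * ε by positivity), div_div]

theorem continuous_tentProfile : Continuous tentProfile := by
  unfold tentProfile
  fun_prop

theorem tentProfile_eq_zero {u : ℝ} (hu : u ∉ Icc (-1 : ℝ) 1) : tentProfile u = 0 := by
  refine max_eq_left ?_
  by_contra h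
  exact hu (abs_le.1 (by linarith))

theorem hasCompactSupport_tentProfile : HasCompactSupport tentProfile :=
  HasCompactSupport.intro isCompact_Icc fun _ => tentProfile_eq_zero

theorem integral_tentProfile : ∫ u, tentProfile u = 1 := by
  rw [← setIntegral_eq_integral_of_forall_compl_eq_zero (s := Icc (-1) 1)
    fun _ => tentProfile_eq_zero]
  rw [integral_Icc_eq_integral_Ioc, ← intervalIntegral.integral_of_le (by norm_num),
    ← intervalIntegral.integral_add_adjacent_intervals (b := 0)
      (continuous_tentProfile.intervalIntegrable _ _)
      (continuous_tentProfile.intervalIntegrable _ _),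
    intervalIntegral.integral_congr (g := fun x => 1 + x),
    intervalIntegral.integral_congr (a := 0) (g := fun x => 1 - x)]
  · rw [intervalIntegral.integral_sub (by simp) (by simp),
      intervalIntegral.integral_add (by simp) (by simp)]
    simp
    norm_num
  · intro x hx
    rw [uIcc_of_le (by norm_num)] at hx
    simp only [tentProfile, abs_of_nonneg hx.1]
    exact max_eq_right (by linarith [hx.2])
  · intro x hx
    rw [uIcc_of_le (by norm_num)] at hx
    simp only [tentProfile, abs_of_nonpos hx.2]
    rw [max_eq_right (by linarith [hx.1])]; ring

theorem lintegral_tent {ε : ℝ} (hε : 0 < ε) : ∫⁻ s : ℝ, ENNReal.ofReal (tent ε |s|) = 1 := by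
  have h : ∀ s : ℝ, tent ε |s| = tentProfile (s / ε) / ε := fun s => by
    rw [tent, tentProfile, abs_div, abs_of_pos hε]
  have hi : Integrable tentProfile :=
    continuous_tentProfile.integrable_of_hasCompactSupport hasCompactSupport_tentProfile
  rw [← ofReal_integral_eq_lintegral_ofReal]
  · simp_rw [h]
    rw [integral_div, Measure.integral_comp_div, integral_tentProfile, abs_of_pos hε, smul_eq_mul,
      mul_one, div_self hε.ne', ENNReal.ofReal_one]
  · simp_rw [h]
    exact (hi.comp_div hε.ne').div_const ε
  · exact ae_of_all _ fun s => tent_nonneg hε _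

/-! ## The dual objective -/

/-- On either diagonal the nearest corner is at distance √2 min(a, 1 - a), and 2√2 · √2 = 4. The two
terms on the right are supported in a ≤ 1/4 and a ≥ 3/4, so at most one of them is nonzero. -/
theorem diagWeight_eq {a b : ℝ} (ha : a ∈ Icc (0 : ℝ) 1) (hb : b = a ∨ b = 1 - a) :
    diagWeight !₂[a, b] = max 0 (1 - 4 * a) + max 0 (1 - 4 * (1 - a)) := by
  have h2 : √2 ^ 2 = 2 := Real.sq_sqrt (by norm_num)
  have hm : cornerDist !₂[a, b] = √2 * min a (1 - a) := by
    refine le_antisymm ?_ ?_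
    · have key : ∀ p q : ℝ, (!₂[p, q] : Plane) ∈
          ({!₂[0, 0], !₂[1, 0], !₂[0, 1], !₂[1, 1]} : Set Plane) →
          (a - p) ^ 2 + (b - q) ^ 2 = 2 * min a (1 - a) ^ 2 →
          cornerDist !₂[a, b] ≤ √2 * min a (1 - a) := by
        intro p q hpq heq
        refine (Metric.infDist_le_dist_of_mem hpq).trans (le_of_eq ?_)
        rw [dist_planePoint]
        simp only [Matrix.cons_val_zero, Matrix.cons_val_one]
        rw [heq, Real.sqrt_mul (by norm_num),
          Real.sqrt_sq (le_min ha.1 (sub_nonneg.2 ha.2))]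
      rcases le_total a (1 - a) with h | h <;> simp only [min_eq_left, min_eq_right, h] at key ⊢
      · rcases hb with rfl | rfl
        · exact key 0 0 (by simp) (by ring)
        · exact key 0 1 (by simp) (by ring)
      · rcases hb with rfl | rfl
        · exact key 1 1 (by simp) (by ring)
        · exact key 1 0 (by simp) (by ring)
    · rw [cornerDist, Metric.le_infDist ⟨!₂[0, 0], by simp⟩]
      have hm0 : 0 ≤ min a (1 - a) := le_min ha.1 (sub_nonneg.2 ha.2)
      have hA : min a (1 - a) ^ 2 ≤ a ^ 2 := pow_le_pow_left₀ hm0 (min_le_left _ _) 2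
      have hB : min a (1 - a) ^ 2 ≤ (1 - a) ^ 2 := pow_le_pow_left₀ hm0 (min_le_right _ _) 2
      simp only [mem_insert_iff, mem_singleton_iff]
      rintro y (rfl | rfl | rfl | rfl) <;> rw [dist_planePoint] <;> apply Real.le_sqrt_of_sq_le <;>
        rw [mul_pow, h2] <;> simp only [Matrix.cons_val_zero, Matrix.cons_val_one]
      all_goals rcases hb with rfl | rfl <;> linarith
  rw [diagWeight, hm, show 1 - 2 * √2 * (√2 * min a (1 - a)) = 1 - 4 * min a (1 - a) by
    linear_combination (-2 * min a (1 - a)) * h2]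
  rcases le_total a (1 - a) with h | h <;> simp only [min_eq_left, min_eq_right, h]
  · rw [max_eq_left (a := (0 : ℝ)) (b := 1 - 4 * (1 - a)) (by linarith), add_zero]
  · rw [max_eq_left (a := (0 : ℝ)) (b := 1 - 4 * a) (by linarith), zero_add]

/-- Each diagonal contributes √2 (1/8 + 1/8), one term for each of its corners. -/
theorem hasDualObjective_dualFun : HasDualObjective dualFun (2 + √2 / 2) := by
  have hA := tendsto_integral_smear continuous_diagWeight continuous_tentProfile
    hasCompactSupport_tentProfile (d := fun x => 1 - x) (by fun_prop)
    fun x hx => ⟨by linarith [hx.2], by linarith [hx.1]⟩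
  have hB := tendsto_integral_smear continuous_diagWeight continuous_tentProfile
    hasCompactSupport_tentProfile (d := fun x => x) (by fun_prop) fun x hx => hx
  have hval : ∀ d : ℝ → ℝ, (∀ x, d x = x ∨ d x = 1 - x) →
      ∫ x in Icc (0 : ℝ) 1, √2 * (diagWeight !₂[x, d x] * ∫ u, tentProfile u) = √2 / 4 := by
    intro d hd
    have hc : Continuous fun x : ℝ => max 0 (1 - 4 * x) := by fun_prop
    have hc' : Continuous fun x : ℝ => max 0 (1 - 4 * (1 - x)) := by fun_prop
    rw [integral_tentProfile, integral_const_mul, setIntegral_congr_fun measurableSet_Icc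
      (g := fun x => max 0 (1 - 4 * x) + max 0 (1 - 4 * (1 - x)))
      fun x hx => by simp only [mul_one]; exact diagWeight_eq hx (hd x),
      integral_add hc.continuousOn.integrableOn_Icc hc'.continuousOn.integrableOn_Icc,
      integral_Icc_comp_one_sub fun x => max 0 (1 - 4 * x), integral_max_one_sub_four_mul]
    ring
  rw [hval _ fun x => Or.inr rfl] at hA
  rw [hval _ fun x => Or.inl rfl] at hB
  have hsum := (hA.add hB).const_add 2
  rw [show 2 + (√2 / 4 + √2 / 4) = 2 + √2 / 2 by ring] at hsum
  refine hsum.congr' ?_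
  filter_upwards [self_mem_nhdsWithin] with ε hε
  have hε : 0 < ε := hε
  have hi : ∀ d : ℝ → ℝ, Continuous d → IntegrableOn (fun x : Plane =>
      diagWeight x * (tentProfile ((x 1 - d (x 0)) / (√2 * ε)) / ε)) square := fun d hd => by
    have := continuous_tentProfile
    exact (Continuous.continuousOn (by fun_prop)).integrableOn_compact isCompact_square
  have h2 : ∫ _x in square, (2 : ℝ) = 2 := by simp [measureReal_def, volume_square]
  rw [← integral_add (hi (fun x => 1 - x) (by fun_prop)) (hi (fun x => x) (by fun_prop))]
  have hI2 : Integrable (fun _ : Plane => (2 : ℝ)) (volume.restrict square) :=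
    integrableOn_const (by simp [volume_square])
  have hI3 : Integrable (fun x : Plane =>
      diagWeight x * (tentProfile ((x 1 - (1 - x 0)) / (√2 * ε)) / ε) +
        diagWeight x * (tentProfile ((x 1 - x 0) / (√2 * ε)) / ε)) (volume.restrict square) :=
    (hi (fun x => 1 - x) (by fun_prop)).add (hi (fun x => x) (by fun_prop))
  nth_rewrite 1 [← h2]
  rw [← integral_add hI2 hI3]
  refine setIntegral_congr_fun measurableSet_square fun x hx => ?_
  simp only [dualFun]
  rw [infDist_diagAB hx, infDist_diagBC hx, tent_eq_tentProfile hε, tent_eq_tentProfile hε, mul_add]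
  congr 6
  simp only [sideDist]; ring

/-! ## Dual feasibility -/

theorem adjacent_or_opposite {i j : Fin 4} (h : i ≠ j) : Adjacent i j ∨ j = i + 2 := by
  revert i j; decide

theorem sepNumber_of_adjacent {i j : Fin 4} (h : Adjacent i j) : sepNumber {AB, BC} i j = 1 := by
  revert i j; decide

theorem sepNumber_opposite (i : Fin 4) : sepNumber {AB, BC} i (i + 2) = 2 := by
  revert i; decide

theorem HasUnitSpeedOn.lipschitzOnWith {c : ℝ → Plane} {s : Set ℝ} (h : HasUnitSpeedOn c s) :
    LipschitzOnWith 1 c s := by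
  have key : ∀ x ∈ s, ∀ y ∈ s, x ≤ y → edist (c x) (c y) ≤ 1 * edist x y := by
    intro x hx y hy hxy
    have h1 := eVariationOn.edist_le c (s := s ∩ Icc x y) ⟨hx, le_rfl, hxy⟩ ⟨hy, hxy, le_rfl⟩
    rw [h hx hy] at h1
    rwa [one_mul, edist_comm x, edist_dist y, Real.dist_eq, abs_of_nonneg (sub_nonneg.2 hxy),
      ← one_mul (y - x)]
  intro x hx y hy
  rcases le_total x y with hxy | hxy
  · exact key x hx y hy hxy
  · rw [edist_comm, edist_comm x]
    exact key y hy x hx hxy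

/-- The integral along a curve of a function of a 1-Lipschitz coordinate is at least the integral
over the values taken by the coordinate. -/
theorem setLIntegral_le_lintegral_comp {s : ℝ → ℝ} {T : Set ℝ} (hT : MeasurableSet T)
    (hs : LipschitzOnWith 1 s T) {f : ℝ → ℝ≥0∞} (hf : Measurable f) {E : Set ℝ}
    (hE : E ⊆ s '' T) : ∫⁻ u in E, f u ≤ ∫⁻ t in T, f (s t) := by
  have hm : AEMeasurable s (volume.restrict T) := hs.continuousOn.aemeasurable hT
  rw [← lintegral_map' hf.aemeasurable hm]
  -- The push-forward of length along the curve dominates Lebesgue measure on `E`, because the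
  -- coordinate does not increase length.
  refine lintegral_mono' (Measure.le_iff.2 fun A hA => ?_) le_rfl
  rw [Measure.map_apply_of_aemeasurable hm hA, Measure.restrict_apply hA,
    Measure.restrict_apply' hT]
  calc volume (A ∩ E) ≤ volume (s '' (s ⁻¹' A ∩ T)) := by
        refine measure_mono ?_
        rintro u ⟨huA, huE⟩
        obtain ⟨t, ht, rfl⟩ := hE huE
        exact ⟨t, ⟨huA, ht⟩, rfl⟩
    _ ≤ volume (s ⁻¹' A ∩ T) := by
        have := (hs.mono (inter_subset_right (s := s ⁻¹' A))).hausdorffMeasure_image_le zero_le_one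
        simpa [hausdorffMeasure_real] using this

/-- The constant contributes 2L. The signed distance `s` from the diagonal runs from negative to
positive at speed at most 1, so the curve collects a full unit of tent mass, weighted by at least 1
- 2L - 2√2 ε. -/
theorem dualFun_integral_of_adjacent {i j : Fin 4} (hij : Adjacent i j) {L : ℝ} {c : ℝ → Plane}
    (hL : 0 < L) (hc : HasUnitSpeedOn c (Icc 0 L)) (hsq : ∀ t ∈ Icc 0 L, c t ∈ square)
    (h0 : c 0 ∈ openSide i) (h1 : c L ∈ openSide j) :
    ∀ᶠ ε in 𝓝[>] 0, ENNReal.ofReal (1 - 2 * √2 * ε) ≤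
      ∫⁻ t in Icc 0 L, ENNReal.ofReal (dualFun ε (c t)) := by
  have hlip := hc.lipschitzOnWith
  have h0m : (0 : ℝ) ∈ Icc 0 L := ⟨le_rfl, hL.le⟩
  have hLm : L ∈ Icc 0 L := ⟨hL.le, le_rfl⟩
  set s : ℝ → ℝ := fun t => (sideDist i (c t) - sideDist j (c t)) / √2 with hsdef
  have hslip : LipschitzOnWith 1 s (Icc 0 L) := by
    have := (lipschitz_sub_sideDist hij).comp_lipschitzOnWith hlip
    rwa [one_mul] at this
  have hi0 : sideDist i (c 0) = 0 := (mem_side_iff.1 (openSide_subset_side _ h0)).2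
  have hjL : sideDist j (c L) = 0 := (mem_side_iff.1 (openSide_subset_side _ h1)).2
  have hs0 : s 0 < 0 := by
    have := sideDist_pos_of_mem_openSide hij.1.symm h0
    simp only [hsdef, hi0]
    exact div_neg_of_neg_of_pos (by linarith) (by positivity)
  have hsL : 0 < s L := by
    have := sideDist_pos_of_mem_openSide hij.1 h1
    simp only [hsdef, hjL]
    exact div_pos (by linarith) (by positivity)
  -- At arc length t the curve is within t of side i and within L - t of side j.
  have hsum : ∀ t ∈ Icc 0 L, sideDist i (c t) + sideDist j (c t) ≤ L := by
    intro t ht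
    have e1 := (abs_sub_sideDist_le i (c t) (c 0)).trans (hlip.dist_le_mul t ht 0 h0m)
    have e2 := (abs_sub_sideDist_le j (c t) (c L)).trans (hlip.dist_le_mul t ht L hLm)
    rw [hi0, NNReal.coe_one, one_mul, Real.dist_eq, sub_zero, sub_zero, abs_of_nonneg ht.1] at e1
    rw [hjL, NNReal.coe_one, one_mul, Real.dist_eq, sub_zero, abs_sub_comm,
      abs_of_nonneg (sub_nonneg.2 ht.2)] at e2
    linarith [le_abs_self (sideDist i (c t)), le_abs_self (sideDist j (c t))]
  -- For such ε the values of `s` cover [-ε, ε], the whole support of the tent.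
  filter_upwards [Ioo_mem_nhdsGT (lt_min (neg_pos.2 hs0) hsL)] with ε hε
  have hε0 : 0 < ε := hε.1
  have hεs := lt_min_iff.1 hε.2
  -- A lower bound for `diagWeight` on the part of the curve with |s| < ε: there `cornerDist_le` and
  -- `hsum` give √2 ρ ≤ L + √2 ε.
  set K := max 0 (1 - 2 * L - 2 * √2 * ε) with hK
  have hpt : ∀ t ∈ Icc 0 L, 2 + K * tent ε |s t| ≤ dualFun ε (c t) := by
    intro t ht
    have hx := hsq t ht
    have habs : |s t| = |sideDist i (c t) - sideDist j (c t)| / √2 := by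
      rw [hsdef, abs_div, abs_of_pos (show (0 : ℝ) < √2 by positivity)]
    have hT : tent ε |s t| ≤
        tent ε (Metric.infDist (c t) diagAB) + tent ε (Metric.infDist (c t) diagBC) := by
      rcases diag_infDist_of_adjacent hij hx with h | h <;> rw [← habs] at h <;> rw [h]
      · exact le_add_of_nonneg_right (tent_nonneg hε0 _)
      · exact le_add_of_nonneg_left (tent_nonneg hε0 _)
    refine add_le_add_right ?_ 2
    rcases le_or_gt ε |s t| with h | h
    · rw [tent_eq_zero hε0 h, mul_zero]
      exact mul_nonneg (diagWeight_nonneg _) (add_nonneg (tent_nonneg hε0 _) (tent_nonneg hε0 _))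
    · refine mul_le_mul (max_le_max le_rfl ?_) hT (tent_nonneg hε0 _) (diagWeight_nonneg _)
      have hcd := cornerDist_le hij hx
      rw [← habs] at hcd
      have h2 : √2 * √2 = 2 := Real.mul_self_sqrt (by norm_num)
      have hle : √2 * cornerDist (c t) ≤ L + √2 * ε := by
        calc √2 * cornerDist (c t)
            ≤ √2 * ((sideDist i (c t) + sideDist j (c t)) / √2 + |s t|) := by gcongr
          _ = sideDist i (c t) + sideDist j (c t) + √2 * |s t| := by field_simp
          _ ≤ L + √2 * ε := by
              have := hsum t ht
              gcongr
      linarith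
  have himg : Icc (-ε) ε ⊆ s '' Icc 0 L := by
    have := hslip.continuousOn.surjOn_uIcc h0m hLm
    refine Subset.trans (Icc_subset_Icc ?_ ?_) ((uIcc_of_le (hs0.trans hsL).le).symm ▸ this)
    · linarith
    · linarith
  have hmt : Measurable fun u : ℝ => ENNReal.ofReal (tent ε |u|) :=
    (Continuous.measurable (by fun_prop)).ennreal_ofReal
  have htent : 1 ≤ ∫⁻ t in Icc 0 L, ENNReal.ofReal (tent ε |s t|) := by
    refine le_trans ?_ (setLIntegral_le_lintegral_comp measurableSet_Icc hslip hmt himg)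
    rw [← lintegral_tent hε0]
    refine le_of_eq (setLIntegral_eq_of_support_subset ?_).symm
    intro u hu
    by_contra h
    refine hu ?_
    simp only
    rw [tent_eq_zero hε0, ENNReal.ofReal_zero]
    by_contra h'
    exact h (abs_le.1 (not_le.1 h').le)
  have hK0 : 0 ≤ K := le_max_left _ _
  calc ENNReal.ofReal (1 - 2 * √2 * ε)
      ≤ ENNReal.ofReal (2 * L + K) := by
        refine ENNReal.ofReal_le_ofReal ?_
        linarith [le_max_right 0 (1 - 2 * L - 2 * √2 * ε)]
    _ = ENNReal.ofReal 2 * volume (Icc 0 L) + ENNReal.ofReal K * 1 := by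
        rw [ENNReal.ofReal_add (by positivity) hK0, ENNReal.ofReal_mul (by norm_num),
          Real.volume_Icc, sub_zero, mul_one]
    _ ≤ ENNReal.ofReal 2 * volume (Icc 0 L) +
        ENNReal.ofReal K * ∫⁻ t in Icc 0 L, ENNReal.ofReal (tent ε |s t|) := by gcongr
    _ ≤ ∫⁻ t in Icc 0 L, (ENNReal.ofReal 2 + ENNReal.ofReal K * ENNReal.ofReal (tent ε |s t|)) := by
        rw [lintegral_add_left measurable_const, lintegral_const_mul' _ _ ENNReal.ofReal_ne_top,
          setLIntegral_const]
    _ ≤ ∫⁻ t in Icc 0 L, ENNReal.ofReal (dualFun ε (c t)) := by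
        refine setLIntegral_mono' measurableSet_Icc fun t ht => ?_
        rw [← ENNReal.ofReal_mul hK0, ← ENNReal.ofReal_add (by norm_num)
          (mul_nonneg hK0 (tent_nonneg hε0 _))]
        exact ENNReal.ofReal_le_ofReal (hpt t ht)

theorem dualFun_integral_of_opposite {i : Fin 4} {L : ℝ} {c : ℝ → Plane}
    (hL : 0 < L) (hc : HasUnitSpeedOn c (Icc 0 L))
    (h0 : c 0 ∈ openSide i) (h1 : c L ∈ openSide (i + 2)) {ε : ℝ} (hε : 0 < ε) :
    2 ≤ ∫⁻ t in Icc 0 L, ENNReal.ofReal (dualFun ε (c t)) := by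
  have hi0 : sideDist i (c 0) = 0 := (mem_side_iff.1 (openSide_subset_side _ h0)).2
  have hjL : sideDist (i + 2) (c L) = 0 := (mem_side_iff.1 (openSide_subset_side _ h1)).2
  have hL1 : 1 ≤ L := by
    have e := (abs_sub_sideDist_le i (c L) (c 0)).trans (hc.lipschitzOnWith.dist_le_mul L
      ⟨hL.le, le_rfl⟩ 0 ⟨le_rfl, hL.le⟩)
    have := sideDist_add_opposite i (c L)
    rw [hi0, NNReal.coe_one, one_mul, Real.dist_eq, sub_zero, sub_zero, abs_of_nonneg hL.le] at e
    linarith [le_abs_self (sideDist i (c L))]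
  calc (2 : ℝ≥0∞) = ∫⁻ _t in Icc (0 : ℝ) 1, 2 := by simp
    _ ≤ ∫⁻ _t in Icc (0 : ℝ) L, 2 := lintegral_mono_set (Icc_subset_Icc_right hL1)
    _ ≤ ∫⁻ t in Icc 0 L, ENNReal.ofReal (dualFun ε (c t)) := by
        refine lintegral_mono fun t => ?_
        rw [← ENNReal.ofReal_ofNat]
        exact ENNReal.ofReal_le_ofReal (two_le_dualFun hε _)

theorem sepNumber_le_liminf {i j : Fin 4} (hij : i ≠ j) {L : ℝ} {c : ℝ → Plane}
    (hL : 0 < L) (hc : HasUnitSpeedOn c (Icc 0 L)) (hsq : ∀ t ∈ Icc 0 L, c t ∈ square)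
    (h0 : c 0 ∈ openSide i) (h1 : c L ∈ openSide j) :
    (sepNumber {AB, BC} i j : ℝ≥0∞) ≤
      liminf (fun ε => ∫⁻ t in Icc 0 L, ENNReal.ofReal (dualFun ε (c t))) (𝓝[>] 0) := by
  by_cases h : j = i + 2
  · subst h
    rw [sepNumber_opposite]
    refine le_liminf_of_le (by isBoundedDefault) ?_
    filter_upwards [self_mem_nhdsWithin] with ε hε
    exact_mod_cast dualFun_integral_of_opposite hL hc h0 h1 hε
  · have hadj : Adjacent i j := (adjacent_or_opposite hij).resolve_right h
    rw [sepNumber_of_adjacent hadj]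
    have ht : Tendsto (fun ε : ℝ => ENNReal.ofReal (1 - 2 * √2 * ε)) (𝓝[>] 0) (𝓝 1) := by
      have : Continuous fun ε : ℝ => ENNReal.ofReal (1 - 2 * √2 * ε) :=
        ENNReal.continuous_ofReal.comp (by fun_prop)
      simpa using (this.tendsto 0).mono_left nhdsWithin_le_nhds
    rw [Nat.cast_one, ← ht.liminf_eq]
    exact liminf_le_liminf (dualFun_integral_of_adjacent hadj hL hc hsq h0 h1)

theorem isDualFeasible_dualFun : IsDualFeasible {AB, BC} dualFun :=
  ⟨fun ε hε => ⟨(continuous_dualFun ε).continuousOn,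
    fun x _ => zero_le_two.trans (two_le_dualFun hε x)⟩,
    fun _ _ hij _ _ hL hc hsq h0 h1 => sepNumber_le_liminf hij.ne hL hc hsq h0 h1⟩

/-! ## Thread configurations -/

theorem eq_corner_of_mem_side {k l : Fin 4} (hkl : k ≠ l) {x : Plane} (hk : x ∈ side k)
    (hl : x ∈ side l) :
    x ∈ ({!₂[0, 0], !₂[1, 0], !₂[0, 1], !₂[1, 1]} : Set Plane) := by
  have hk := (mem_side_iff.1 hk).2
  have hl := (mem_side_iff.1 hl).2
  have key : ∀ a b : ℝ, (a = 0 ∨ a = 1) → (b = 0 ∨ b = 1) → x 0 = a → x 1 = b →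
      x ∈ ({!₂[0, 0], !₂[1, 0], !₂[0, 1], !₂[1, 1]} : Set Plane) := by
    intro a b ha hb h0 h1
    have : x = !₂[a, b] := by ext i; fin_cases i <;> simp [h0, h1]
    rw [this]
    rcases ha with rfl | rfl <;> rcases hb with rfl | rfl <;> simp
  have h0 : x 0 = 0 ∨ x 0 = 1 := by
    revert hkl
    fin_cases k <;> fin_cases l <;> intro hkl <;> first | exact absurd rfl hkl | skip
    all_goals simp only [sideDist] at hk hl
    all_goals first | exact Or.inl (by linarith) | exact Or.inr (by linarith)
  have h1 : x 1 = 0 ∨ x 1 = 1 := by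
    revert hkl
    fin_cases k <;> fin_cases l <;> intro hkl <;> first | exact absurd rfl hkl | skip
    all_goals simp only [sideDist] at hk hl
    all_goals first | exact Or.inl (by linarith) | exact Or.inr (by linarith)
  exact key _ _ h0 h1 rfl rfl

/-- Rewrites the separation number in the form of the membership conditions in `crossing` and
`flux_eq`. -/
theorem sepNumber_eq (i j : Fin 4) : sepNumber {AB, BC} i j =
    (if (i ∈ AB ∧ j ∈ ABᶜ) ∨ (i ∈ ABᶜ ∧ j ∈ AB) then 1 else 0) +
      (if (i ∈ BC ∧ j ∈ BCᶜ) ∨ (i ∈ BCᶜ ∧ j ∈ BC) then 1 else 0) := by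
  revert i j; decide

namespace ThreadConfiguration

variable {Ω : Type*} [MeasurableSpace Ω] (P : ThreadConfiguration Ω)

/-- The length measure of a thread. -/
noncomputable def lengthMeasure (w : Ω) : Measure Plane :=
  (volume.restrict (Icc 0 (P.len w))).map (P.path w)

theorem measurable_path_apply (w : Ω) : Measurable (P.path w) :=
  P.measurable_path.comp (by fun_prop : Measurable fun t : ℝ => (w, t))

theorem measurable_start : Measurable fun w => P.path w 0 :=
  P.measurable_path.comp (by fun_prop : Measurable fun w : Ω => (w, (0 : ℝ)))

theorem measurable_finish : Measurable fun w => P.path w (P.len w) :=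
  P.measurable_path.comp (measurable_id.prodMk P.measurable_len)

theorem lengthMeasure_apply (w : Ω) {U : Set Plane} (hU : MeasurableSet U) :
    P.lengthMeasure w U = P.lengthIn w U := by
  rw [lengthMeasure, Measure.map_apply (P.measurable_path_apply w) hU,
    Measure.restrict_apply (P.measurable_path_apply w hU), inter_comm]
  rfl

theorem measurable_lengthIn {U : Set Plane} (hU : MeasurableSet U) :
    Measurable fun w => P.lengthIn w U := by
  have : MeasurableSet {p : Ω × ℝ | p.2 ∈ Icc 0 (P.len p.1) ∧ P.path p.1 p.2 ∈ U} := by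
    refine MeasurableSet.inter (MeasurableSet.inter ?_ ?_) (P.measurable_path hU)
    · exact measurableSet_le measurable_const measurable_snd
    · exact measurableSet_le measurable_snd (P.measurable_len.comp measurable_fst)
  exact measurable_measure_prodMk_left this

theorem measurable_lengthMeasure : Measurable P.lengthMeasure :=
  Measure.measurable_of_measurable_coe _ fun U hU => by
    simp_rw [P.lengthMeasure_apply _ hU]
    exact P.measurable_lengthIn hU

theorem setLIntegral_path (w : Ω) {f : Plane → ℝ≥0∞} (hf : Measurable f) :
    ∫⁻ t in Icc 0 (P.len w), f (P.path w t) = ∫⁻ x, f x ∂P.lengthMeasure w :=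
  (lintegral_map hf (P.measurable_path_apply w)).symm

theorem lengthIn_inter_square (w : Ω) (U : Set Plane) :
    P.lengthIn w (U ∩ square) = P.lengthIn w U := by
  unfold lengthIn
  congr 1
  ext t
  exact ⟨fun h => ⟨h.1, h.2.1⟩, fun h => ⟨h.1, h.2, P.mem_square w t h.1⟩⟩

/-- The density condition says that the weighted sum of the length measures of the threads is at
most Lebesgue measure on the square; this is the same inequality tested on functions. -/
theorem lintegral_path_le {P : ThreadConfiguration Ω} (hP : P.NuVLeOne) {f : Plane → ℝ≥0∞}
    (hf : Measurable f) :
    ∫⁻ w, (∫⁻ t in Icc 0 (P.len w), f (P.path w t)) ∂P.weight ≤ ∫⁻ x in square, f x := by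
  simp_rw [P.setLIntegral_path _ hf]
  rw [← Measure.lintegral_bind P.measurable_lengthMeasure.aemeasurable hf.aemeasurable]
  refine lintegral_mono' (Measure.le_iff.2 fun U hU => ?_) le_rfl
  rw [Measure.bind_apply hU P.measurable_lengthMeasure.aemeasurable, Measure.restrict_apply hU]
  simp_rw [P.lengthMeasure_apply _ hU, ← P.lengthIn_inter_square _ U]
  exact hP _ (hU.inter measurableSet_square) inter_subset_right

theorem ofReal_le_lengthIn_closedBall {w : Ω} {q : Plane}
    (hq : P.path w 0 = q ∨ P.path w (P.len w) = q) {r : ℝ} (hrw : r ≤ P.len w) :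
    ENNReal.ofReal r ≤ P.lengthIn w (Metric.closedBall q r ∩ square) := by
  rw [lengthIn_inter_square]
  have hlip := HasUnitSpeedOn.lipschitzOnWith (P.unitSpeed w)
  have hlen := (P.len_pos w).le
  rcases hq with rfl | rfl
  · calc ENNReal.ofReal r = volume (Icc 0 r) := by rw [Real.volume_Icc, sub_zero]
      _ ≤ _ := measure_mono fun t ht => by
        have htm : t ∈ Icc 0 (P.len w) := ⟨ht.1, ht.2.trans hrw⟩
        refine ⟨htm, (hlip.dist_le_mul t htm 0 ⟨le_rfl, hlen⟩).trans ?_⟩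
        rw [NNReal.coe_one, one_mul, Real.dist_eq, sub_zero, abs_of_nonneg ht.1]
        exact ht.2
  · calc ENNReal.ofReal r = volume (Icc (P.len w - r) (P.len w)) := by
          rw [Real.volume_Icc, sub_sub_cancel]
      _ ≤ _ := measure_mono fun t ht => by
        have htm : t ∈ Icc 0 (P.len w) := ⟨by linarith [ht.1], ht.2⟩
        refine ⟨htm, (hlip.dist_le_mul t htm _ ⟨hlen, le_rfl⟩).trans ?_⟩
        rw [NNReal.coe_one, one_mul, Real.dist_eq, abs_sub_comm,
          abs_of_nonneg (sub_nonneg.2 ht.2)]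
        linarith [ht.1]

/-- Almost no thread ends at a given point. -/
theorem ae_endpoint_ne {P : ThreadConfiguration Ω} (hP : P.NuVLeOne) (q : Plane) :
    ∀ᵐ w ∂P.weight, P.path w 0 ≠ q ∧ P.path w (P.len w) ≠ q := by
  have hlong : ∀ l : ℝ, 0 < l →
      P.weight {w | (P.path w 0 = q ∨ P.path w (P.len w) = q) ∧ l ≤ P.len w} = 0 := by
    intro l hl
    set E := {w | (P.path w 0 = q ∨ P.path w (P.len w) = q) ∧ l ≤ P.len w}
    have hr : ∀ r ∈ Ioo 0 l, P.weight E ≤ ENNReal.ofReal r * ENNReal.ofReal Real.pi := by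
      intro r hr
      have hU : MeasurableSet (Metric.closedBall q r ∩ square) :=
        Metric.isClosed_closedBall.measurableSet.inter measurableSet_square
      -- Each thread of `E` spends length at least r in the disc of radius r about `q`, whose area
      -- is π r². Markov's inequality then bounds the weight of `E` by π r, for every small r.
      have h1 : ENNReal.ofReal r * P.weight E ≤
          ENNReal.ofReal r * (ENNReal.ofReal r * ENNReal.ofReal Real.pi) :=
        calc ENNReal.ofReal r * P.weight E
            ≤ ENNReal.ofReal r * P.weight
                {w | ENNReal.ofReal r ≤ P.lengthIn w (Metric.closedBall q r ∩ square)} := by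
              gcongr
              rintro w ⟨hw, hlw⟩
              exact P.ofReal_le_lengthIn_closedBall hw (hr.2.le.trans hlw)
          _ ≤ ∫⁻ w, P.lengthIn w (Metric.closedBall q r ∩ square) ∂P.weight :=
              mul_meas_ge_le_lintegral (P.measurable_lengthIn hU) _
          _ ≤ volume (Metric.closedBall q r ∩ square) := hP _ hU inter_subset_right
          _ ≤ volume (Metric.closedBall q r) := measure_mono inter_subset_left
          _ = ENNReal.ofReal r * (ENNReal.ofReal r * ENNReal.ofReal Real.pi) := by
              rw [EuclideanSpace.volume_closedBall_fin_two, pow_two, mul_assoc]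
      exact (ENNReal.mul_le_mul_iff_right (by simpa using hr.1) ENNReal.ofReal_ne_top).1 h1
    refine le_antisymm (ge_of_tendsto (f := fun r : ℝ => ENNReal.ofReal r * ENNReal.ofReal Real.pi)
      (x := 𝓝[>] 0) ?_ ?_) zero_le
    · have : Tendsto (fun r : ℝ => ENNReal.ofReal r * ENNReal.ofReal Real.pi) (𝓝 0)
          (𝓝 (ENNReal.ofReal 0 * ENNReal.ofReal Real.pi)) :=
        ENNReal.Tendsto.mul_const (ENNReal.continuous_ofReal.tendsto 0)
          (Or.inr ENNReal.ofReal_ne_top)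
      simpa using this.mono_left (nhdsWithin_le_nhds (s := Ioi 0))
    · filter_upwards [Ioo_mem_nhdsGT hl] with r h using hr r h
  -- Lengths are positive but have no common lower bound, so the threads are exhausted by the
  -- countably many conditions length ≥ 1/(n+1).
  have hall : ∀ᵐ w ∂P.weight, ∀ n : ℕ,
      ¬ ((P.path w 0 = q ∨ P.path w (P.len w) = q) ∧ 1 / ((n : ℝ) + 1) ≤ P.len w) := by
    rw [ae_all_iff]
    intro n
    rw [ae_iff]
    simpa only [not_not] using hlong (1 / ((n : ℝ) + 1)) (by positivity)
  filter_upwards [hall] with w hw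
  obtain ⟨n, hn⟩ := exists_nat_one_div_lt (P.len_pos w)
  rw [← not_or]
  exact fun h => hw n ⟨h, hn.le⟩

/-- Almost no thread ends at a corner. -/
theorem ae_endpoint_unique {P : ThreadConfiguration Ω} (hP : P.NuVLeOne) :
    ∀ᵐ w ∂P.weight, ∀ k l : Fin 4,
      (P.path w 0 ∈ side k → P.path w 0 ∈ side l → k = l) ∧
      (P.path w (P.len w) ∈ side k → P.path w (P.len w) ∈ side l → k = l) := by
  have h : ∀ᵐ w ∂P.weight, ∀ q ∈ ({!₂[0, 0], !₂[1, 0], !₂[0, 1], !₂[1, 1]} : Set Plane),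
      P.path w 0 ≠ q ∧ P.path w (P.len w) ≠ q := by
    rw [ae_ball_iff (Set.toFinite _).countable]
    exact fun q _ => ae_endpoint_ne hP q
  filter_upwards [h] with w hw k l
  constructor <;> intro hk hl <;> by_contra hkl
  · exact (hw _ (eq_corner_of_mem_side hkl hk hl)).1 rfl
  · exact (hw _ (eq_corner_of_mem_side hkl hk hl)).2 rfl

/-- The threads that connect `A_I` with the complementary region. -/
def crossing (I : Finset (Fin 4)) : Set Ω :=
  {w | (P.path w 0 ∈ region I ∧ P.path w (P.len w) ∈ region Iᶜ) ∨
    (P.path w 0 ∈ region Iᶜ ∧ P.path w (P.len w) ∈ region I)}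

theorem measurableSet_crossing (I : Finset (Fin 4)) : MeasurableSet (P.crossing I) := by
  have h0 : ∀ J, MeasurableSet {w | P.path w 0 ∈ region J} := fun J =>
    P.measurable_start (isClosed_region J).measurableSet
  have h1 : ∀ J, MeasurableSet {w | P.path w (P.len w) ∈ region J} := fun J =>
    P.measurable_finish (isClosed_region J).measurableSet
  exact ((h0 I).inter (h1 Iᶜ)).union ((h0 Iᶜ).inter (h1 I))

/-- The number of the regions `AB`, `BC` that a thread crosses is bounded by its integral
of the dual function. -/
theorem indicator_crossing_le_liminf {w : Ω}
    (hw : ∀ k l : Fin 4, (P.path w 0 ∈ side k → P.path w 0 ∈ side l → k = l) ∧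
      (P.path w (P.len w) ∈ side k → P.path w (P.len w) ∈ side l → k = l)) :
    (P.crossing AB).indicator 1 w + (P.crossing BC).indicator 1 w ≤
      liminf (fun ε => ∫⁻ t in Icc 0 (P.len w), ENNReal.ofReal (dualFun ε (P.path w t)))
        (𝓝[>] 0) := by
  by_cases hend : ∃ i j, P.path w 0 ∈ side i ∧ P.path w (P.len w) ∈ side j ∧ i ≠ j
  · obtain ⟨i, j, hi, hj, hij⟩ := hend
    have hi' : P.path w 0 ∈ openSide i :=
      mem_openSide_iff.2 ⟨hi, fun l hl h => hl ((hw l i).1 h hi)⟩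
    have hj' : P.path w (P.len w) ∈ openSide j :=
      mem_openSide_iff.2 ⟨hj, fun l hl h => hl ((hw l j).2 h hj)⟩
    refine le_trans ?_ (sepNumber_le_liminf hij (P.len_pos w) (P.unitSpeed w)
      (P.mem_square w) hi' hj')
    have hr0 : ∀ J, P.path w 0 ∈ region J → i ∈ J := fun J h => by
      obtain ⟨k, hk, hk'⟩ := mem_region_iff.1 h
      rwa [(hw i k).1 hi hk']
    have hr1 : ∀ J, P.path w (P.len w) ∈ region J → j ∈ J := fun J h => by
      obtain ⟨k, hk, hk'⟩ := mem_region_iff.1 h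
      rwa [(hw j k).2 hj hk']
    have hI : ∀ I, (P.crossing I).indicator (1 : Ω → ℝ≥0∞) w ≤
        ((if (i ∈ I ∧ j ∈ Iᶜ) ∨ (i ∈ Iᶜ ∧ j ∈ I) then 1 else 0 : ℕ) : ℝ≥0∞) := by
      intro I
      by_cases h : w ∈ P.crossing I
      · rw [indicator_of_mem h, if_pos, Nat.cast_one, Pi.one_apply]
        exact h.imp (fun h => ⟨hr0 _ h.1, hr1 _ h.2⟩) (fun h => ⟨hr0 _ h.1, hr1 _ h.2⟩)
      · rw [indicator_of_notMem h]; exact zero_le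
    rw [sepNumber_eq, Nat.cast_add]
    exact add_le_add (hI _) (hI _)
  -- A crossing thread has its ends on sides with different indices, one in I and one outside, so
  -- here nothing is crossed.
  · have hI : ∀ I, (P.crossing I).indicator (1 : Ω → ℝ≥0∞) w = 0 := by
      intro I
      refine indicator_of_notMem (fun h => hend ?_) _
      rcases h with ⟨h0, h1⟩ | ⟨h0, h1⟩ <;>
        obtain ⟨i, hi, hi'⟩ := mem_region_iff.1 h0 <;>
        obtain ⟨j, hj, hj'⟩ := mem_region_iff.1 h1 <;>
        refine ⟨i, j, hi', hj', ?_⟩ <;> rintro rfl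
      · exact (Finset.mem_compl.1 hj) hi
      · exact (Finset.mem_compl.1 hi) hj
    rw [hI, hI, add_zero]
    exact zero_le

theorem number_add_number_le {P : ThreadConfiguration Ω} (hP : P.NuVLeOne) :
    P.number AB + P.number BC ≤ ENNReal.ofReal (2 + √2 / 2) := by
  -- Fatou's lemma is applied along this sequence of widths tending to 0.
  set u : ℕ → ℝ := fun n => 1 / ((n : ℝ) + 1)
  have hu : Tendsto u atTop (𝓝[>] 0) := tendsto_nhdsWithin_iff.2
    ⟨tendsto_one_div_add_atTop_nhds_zero_nat, Eventually.of_forall fun n =>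
      show 0 < 1 / ((n : ℝ) + 1) by positivity⟩
  have hmeas : ∀ ε, Measurable fun x => ENNReal.ofReal (dualFun ε x) := fun ε =>
    (continuous_dualFun ε).measurable.ennreal_ofReal
  have hobj : Tendsto (fun n => ∫⁻ x in square, ENNReal.ofReal (dualFun (u n) x)) atTop
      (𝓝 (ENNReal.ofReal (2 + √2 / 2))) := by
    refine ((ENNReal.continuous_ofReal.tendsto _).comp
      (hasDualObjective_dualFun.comp hu)).congr fun n => ?_
    refine ofReal_integral_eq_lintegral_ofReal
      ((continuous_dualFun _).continuousOn.integrableOn_compact isCompact_square)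
      (ae_of_all _ fun x => ?_)
    exact zero_le_two.trans (two_le_dualFun (show 0 < 1 / ((n : ℝ) + 1) by positivity) x)
  calc P.number AB + P.number BC
      = ∫⁻ w, ((P.crossing AB).indicator 1 w + (P.crossing BC).indicator 1 w) ∂P.weight := by
        rw [lintegral_add_left (measurable_one.indicator (P.measurableSet_crossing AB)),
          lintegral_indicator_one (P.measurableSet_crossing AB),
          lintegral_indicator_one (P.measurableSet_crossing BC)]
        rfl
    _ ≤ ∫⁻ w, (liminf (fun n => ∫⁻ t in Icc 0 (P.len w),
          ENNReal.ofReal (dualFun (u n) (P.path w t))) atTop) ∂P.weight := by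
        refine lintegral_mono_ae ?_
        filter_upwards [ae_endpoint_unique hP] with w hw
        refine (P.indicator_crossing_le_liminf hw).trans ?_
        exact (liminf_le_liminf_of_le hu).trans_eq (liminf_comp _ _ _).symm
    _ ≤ liminf (fun n => ∫⁻ w, (∫⁻ t in Icc 0 (P.len w),
          ENNReal.ofReal (dualFun (u n) (P.path w t))) ∂P.weight) atTop := by
        refine lintegral_liminf_le fun n => ?_
        simp_rw [P.setLIntegral_path _ (hmeas _)]
        exact (Measure.measurable_lintegral (hmeas _)).comp P.measurable_lengthMeasure
    _ ≤ liminf (fun n => ∫⁻ x in square, ENNReal.ofReal (dualFun (u n) x)) atTop :=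
        liminf_le_liminf (Eventually.of_forall fun n => lintegral_path_le hP (hmeas _))
    _ = ENNReal.ofReal (2 + √2 / 2) := hobj.liminf_eq

end ThreadConfiguration

theorem two_add_lt : 2 + √2 / 2 < √2 + √2 := by
  nlinarith [Real.sq_sqrt (show (0 : ℝ) ≤ 2 by norm_num), Real.sqrt_nonneg 2]

theorem ThreadConfiguration.not_locks {Ω : Type*} [MeasurableSpace Ω] {P : ThreadConfiguration Ω}
    (hP : P.NuVLeOne) : ¬ P.Locks {AB, BC} := by
  intro h
  have hle := number_add_number_le hP
  rw [h AB (by simp), h BC (by simp), S_AB, S_BC,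
    ← ENNReal.ofReal_add (by positivity) (by positivity),
    ENNReal.ofReal_le_ofReal_iff (by positivity)] at hle
  exact absurd hle (not_le.2 two_add_lt)

/-- The bundles partition the threads, so their densities |v_ij| add up to the total density, which
the multiflow bounds by 1. -/
theorem ThreadConfiguration.Underlies.nuVLeOne {Ω : Type*} [MeasurableSpace Ω]
    {P : ThreadConfiguration Ω} {V : NuVMultiflow} (h : P.Underlies V) : P.NuVLeOne := by
  obtain ⟨bundle, hb, hbp, hdens⟩ := h
  intro U hU hUs
  have hsplit : ∫⁻ w, P.lengthIn w U ∂P.weight =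
      ∑ p ∈ pairs, ∫⁻ w in bundle ⁻¹' {p}, P.lengthIn w U ∂P.weight := by
    rw [← lintegral_biUnion_finset]
    · rw [show ⋃ p ∈ pairs, bundle ⁻¹' {p} = univ from eq_univ_of_forall fun w => by
        simpa using hbp w, Measure.restrict_univ]
    · intro p _ q _ hpq
      exact Disjoint.preimage _ (by simpa using hpq)
    · exact fun p _ => hb (measurableSet_singleton p)
  have hres : volume.restrict U ≤ volume.restrict square := Measure.restrict_mono hUs le_rfl
  rw [hsplit, Finset.sum_congr rfl fun p hp => (hdens p hp).1 U hU hUs,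
    ← lintegral_finsetSum' _ fun p hp => ((V.aestronglyMeasurable p hp).mono_measure hres).enorm]
  calc ∫⁻ x in U, ∑ p ∈ pairs, ‖V.field p x‖ₑ ≤ ∫⁻ _x in U, 1 := by
        refine lintegral_mono_ae (ae_mono hres ?_)
        filter_upwards [V.density_le] with x hx
        simp_rw [← ofReal_norm]
        rw [← ENNReal.ofReal_sum_of_nonneg fun _ _ => norm_nonneg _]
        exact ENNReal.ofReal_le_one.2 hx
    _ = volume U := by simp

/-! ## Smooth profiles -/

/-- A smooth approximation, from below, to `min (2 t) (1 / 2)`. -/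
structure IsCap (δ : ℝ) (α : ℝ → ℝ) : Prop where
  contDiff : ContDiff ℝ ∞ α
  zero : α 0 = 0
  deriv_nonneg : ∀ t, 0 ≤ deriv α t
  deriv_le : ∀ t, deriv α t ≤ 2
  nonneg : ∀ t, 0 ≤ t → 0 ≤ α t
  le_half : ∀ t, 0 ≤ t → α t ≤ 1 / 2
  one_sub_le : ∀ t, 0 ≤ t → 1 - 2 * α t ≤ max 0 (1 - 4 * t) + 4 * δ

/-- The cap is the integral of a smooth cut-off that falls from 2 to 0 on [1/4 - δ, 1/4]. It equals
2t up to 1/4 - δ and is constant beyond 1/4; the error 4δ is the value of 1 - 2α at 1/4 - δ. -/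
theorem exists_isCap {δ : ℝ} (hδ : 0 < δ) (hδ' : δ ≤ 1 / 4) : ∃ α, IsCap δ α := by
  set g : ℝ → ℝ := fun s => 2 * Real.smoothTransition ((1 / 4 - s) / δ) with hg
  have hgs : ContDiff ℝ ∞ g :=
    contDiff_const.mul (Real.smoothTransition.contDiff.comp (by fun_prop))
  have hgc : Continuous g := hgs.continuous
  have hg0 : ∀ s, 0 ≤ g s := fun s => mul_nonneg zero_le_two (Real.smoothTransition.nonneg _)
  have hg2 : ∀ s, g s ≤ 2 := fun s => by
    have := Real.smoothTransition.le_one ((1 / 4 - s) / δ)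
    simp only [hg]; linarith
  have hderiv : ∀ t, HasDerivAt (fun t => ∫ s in (0 : ℝ)..t, g s) (g t) t := fun t =>
    hgc.integral_hasStrictDerivAt 0 t |>.hasDerivAt
  have hd : deriv (fun t => ∫ s in (0 : ℝ)..t, g s) = g := funext fun t => (hderiv t).deriv
  have hmono : Monotone (fun t => ∫ s in (0 : ℝ)..t, g s) :=
    monotone_of_deriv_nonneg (fun t => (hderiv t).differentiableAt) fun t => by
      rw [hd]; exact hg0 t
  have hi : ∀ a b, IntervalIntegrable g volume a b := fun a b => hgc.intervalIntegrable a b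
  have hlin : ∀ t, 0 ≤ t → ∫ s in (0 : ℝ)..t, g s ≤ 2 * t := fun t ht => by
    calc ∫ s in (0 : ℝ)..t, g s ≤ ∫ _s in (0 : ℝ)..t, 2 :=
          intervalIntegral.integral_mono_on ht (hi _ _) (by simp) fun s _ => hg2 s
      _ = 2 * t := by simp [mul_comm]
  have hexact : ∀ t, t ≤ 1 / 4 - δ → ∫ s in (0 : ℝ)..t, g s = 2 * t := fun t ht => by
    rw [intervalIntegral.integral_congr (g := fun _ => 2)]
    · simp [mul_comm]
    · intro s hs
      have hs' : s ≤ 1 / 4 - δ := hs.2.trans (max_le (by linarith) ht)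
      simp only [hg]
      rw [Real.smoothTransition.one_of_one_le, mul_one]
      rw [one_le_div hδ]
      linarith
  refine ⟨fun t => ∫ s in (0 : ℝ)..t, g s, ?_, by simp, ?_, ?_, ?_, ?_, ?_⟩
  · rw [contDiff_infty_iff_deriv, hd]
    exact ⟨fun t => (hderiv t).differentiableAt, hgs⟩
  · rw [hd]; exact hg0
  · rw [hd]; exact hg2
  · intro t ht
    exact intervalIntegral.integral_nonneg ht fun s _ => hg0 s
  · intro t ht
    rcases le_total t (1 / 4) with h | h
    · exact (hlin t ht).trans (by linarith)
    · have : ∫ s in (1 / 4 : ℝ)..t, g s = 0 := by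
        rw [intervalIntegral.integral_congr (g := fun _ => 0)]
        · simp
        · intro s hs
          rw [uIcc_of_le h] at hs
          simp only [hg]
          rw [Real.smoothTransition.zero_of_nonpos, mul_zero]
          exact div_nonpos_of_nonpos_of_nonneg (by linarith [hs.1]) hδ.le
      rw [← intervalIntegral.integral_add_adjacent_intervals (hi 0 (1 / 4)) (hi (1 / 4) t), this,
        add_zero]
      exact (hlin _ (by norm_num)).trans (by norm_num)
  · intro t ht
    rcases le_total t (1 / 4 - δ) with h | h
    · simp only [hexact t h]
      linarith [le_max_right 0 (1 - 4 * t)]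
    · have := hmono h
      simp only [hexact _ le_rfl] at this
      linarith [le_max_left 0 (1 - 4 * t)]

/-- A smooth step from `0` to `1`. -/
noncomputable def step (t : ℝ) : ℝ := Real.smoothTransition ((t + 1) / 2)

theorem contDiff_step : ContDiff ℝ ∞ step :=
  Real.smoothTransition.contDiff.comp (by fun_prop)

theorem step_nonneg (t : ℝ) : 0 ≤ step t := Real.smoothTransition.nonneg _

theorem step_le_one (t : ℝ) : step t ≤ 1 := Real.smoothTransition.le_one _

theorem step_eq_zero {t : ℝ} (ht : t ≤ -1) : step t = 0 :=
  Real.smoothTransition.zero_of_nonpos (by linarith)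

theorem step_eq_one {t : ℝ} (ht : 1 ≤ t) : step t = 1 :=
  Real.smoothTransition.one_of_one_le (by linarith)

theorem monotone_step : Monotone step := fun _ _ h =>
  Real.smoothTransition.monotone (by linarith)

theorem deriv_step_nonneg (t : ℝ) : 0 ≤ deriv step t := monotone_step.deriv_nonneg

theorem continuous_deriv_step : Continuous (deriv step) :=
  contDiff_step.continuous_deriv (by simp)

theorem deriv_step_eq_zero {t : ℝ} (ht : t ∉ Icc (-1 : ℝ) 1) : deriv step t = 0 := by
  rw [mem_Icc, not_and_or, not_le, not_le] at ht
  rcases ht with h | h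
  · have : step =ᶠ[𝓝 t] fun _ => 0 := by
      filter_upwards [Iio_mem_nhds h] with s hs using step_eq_zero (le_of_lt hs)
    rw [this.deriv_eq, deriv_const]
  · have : step =ᶠ[𝓝 t] fun _ => 1 := by
      filter_upwards [Ioi_mem_nhds h] with s hs using step_eq_one (le_of_lt hs)
    rw [this.deriv_eq, deriv_const]

theorem hasCompactSupport_deriv_step : HasCompactSupport (deriv step) :=
  HasCompactSupport.intro isCompact_Icc fun _ => deriv_step_eq_zero

theorem integral_deriv_step : ∫ t, deriv step t = 1 := by
  rw [← setIntegral_eq_integral_of_forall_compl_eq_zero (s := Icc (-1) 1)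
    fun _ => deriv_step_eq_zero, integral_Icc_eq_integral_Ioc,
    ← intervalIntegral.integral_of_le (by norm_num),
    intervalIntegral.integral_deriv_eq_sub
      (fun t _ => (contDiff_step.differentiable (by simp)).differentiableAt)
      (continuous_deriv_step.intervalIntegrable _ _),
    step_eq_one le_rfl, step_eq_zero le_rfl, sub_zero]

/-! ## Potentials -/

theorem contDiff_sideDist (k : Fin 4) : ContDiff ℝ ∞ (sideDist k) := by
  have h : ∀ i : Fin 2, ContDiff ℝ ∞ fun x : Plane => x i := fun i => by fun_prop
  fin_cases k <;> unfold sideDist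
  · exact h 0
  · exact h 1
  · exact contDiff_const.sub (h 0)
  · exact contDiff_const.sub (h 1)

theorem lipschitz_sideDist (k : Fin 4) : LipschitzWith 1 (sideDist k) :=
  LipschitzWith.of_dist_le_mul fun x y => by
    simpa [Real.dist_eq] using abs_sub_sideDist_le k x y

/-- A smooth function that is about `0` on the side `i` and `1` on the adjacent side `j`, with a
steep gradient across the diagonal between them. -/
noncomputable def cornerPotential (α : ℝ → ℝ) (ε : ℝ) (i j : Fin 4) (x : Plane) : ℝ :=
  α (sideDist i x) * step ((sideDist j x - sideDist i x) / √2 / ε) +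
    (1 - α (sideDist j x)) * (1 - step ((sideDist j x - sideDist i x) / √2 / ε))

/-- The bound for the steep part of the gradient of `cornerPotential`. -/
noncomputable def steepness (α : ℝ → ℝ) (ε : ℝ) (i j : Fin 4) (x : Plane) : ℝ :=
  (1 - α (sideDist i x) - α (sideDist j x)) *
    (deriv step ((sideDist j x - sideDist i x) / √2 / ε) / ε)

variable {δ : ℝ} {α : ℝ → ℝ}

theorem IsCap.contDiff_cornerPotential (hα : IsCap δ α) (ε : ℝ) (i j : Fin 4) :
    ContDiff ℝ ∞ (cornerPotential α ε i j) := by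
  have hi := contDiff_sideDist i
  have hj := contDiff_sideDist j
  have hs : ContDiff ℝ ∞ fun x => step ((sideDist j x - sideDist i x) / √2 / ε) :=
    contDiff_step.comp (((hj.sub hi).div_const _).div_const _)
  exact ((hα.contDiff.comp hi).mul hs).add
    ((contDiff_const.sub (hα.contDiff.comp hj)).mul (contDiff_const.sub hs))

theorem IsCap.continuous_steepness (hα : IsCap δ α) (ε : ℝ) (i j : Fin 4) :
    Continuous (steepness α ε i j) := by
  have h1 := hα.contDiff.continuous
  have h2 := continuous_deriv_step
  unfold steepness
  fun_prop

theorem IsCap.steepness_nonneg (hα : IsCap δ α) {ε : ℝ} (hε : 0 < ε) (i j : Fin 4) {x : Plane}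
    (hx : x ∈ square) : 0 ≤ steepness α ε i j x := by
  have hi := hα.le_half _ (mem_square_iff.1 hx i)
  have hj := hα.le_half _ (mem_square_iff.1 hx j)
  exact mul_nonneg (by linarith) (div_nonneg (deriv_step_nonneg _) hε.le)

/-- With H the step, the two slope terms carry weights H and 1 - H, so together they are bounded by
2 and not by 4. The remaining term differentiates H and is the jump times a unit-normalized gradient
across the diagonal. -/
theorem IsCap.abs_fderiv_cornerPotential_le (hα : IsCap δ α) {ε : ℝ} (hε : 0 < ε) {i j : Fin 4}
    (hij : Adjacent i j) {x : Plane} (hx : x ∈ square) (v : Plane) :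
    |fderiv ℝ (cornerPotential α ε i j) x v| ≤ (2 + steepness α ε i j x) * ‖v‖ := by
  set a := sideDist i x with ha
  set b := sideDist j x with hb
  set s := (b - a) / √2 with hs
  have hdi := (contDiff_sideDist i).differentiable (by simp) x |>.hasFDerivAt
  have hdj := (contDiff_sideDist j).differentiable (by simp) x |>.hasFDerivAt
  have hds : DifferentiableAt ℝ (fun y => (sideDist j y - sideDist i y) / √2) x :=
    (((contDiff_sideDist j).sub (contDiff_sideDist i)).div_const √2).differentiable (by simp) x
  have hαd : ∀ t, HasDerivAt α (deriv α t) t := fun t =>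
    (hα.contDiff.differentiable (by simp) t).hasDerivAt
  have hstep := (contDiff_step.differentiable (by simp) (s / ε)).hasDerivAt
  have hH : HasFDerivAt (fun y => step ((sideDist j y - sideDist i y) / √2 / ε))
      ((deriv step (s / ε) / ε) • fderiv ℝ (fun y => (sideDist j y - sideDist i y) / √2) x) x := by
    have := (hstep.div_const 1).comp_hasFDerivAt x
      (f := fun y => (sideDist j y - sideDist i y) / √2 / ε) (f' := ε⁻¹ •
        fderiv ℝ (fun y => (sideDist j y - sideDist i y) / √2) x) ?_
    · simpa [smul_smul, div_eq_mul_inv, Function.comp_def] using this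
    · simpa [div_eq_inv_mul] using hds.hasFDerivAt.const_mul ε⁻¹
  have hA := (hαd a).comp_hasFDerivAt x hdi
  have hB := (hαd b).comp_hasFDerivAt x hdj
  have htot := (hA.mul hH).add ((hB.const_sub 1).mul (hH.const_sub 1))
  have hfd := congrArg (fun l => l v) htot.fderiv
  set da := fderiv ℝ (sideDist i) x v with hda
  set db := fderiv ℝ (sideDist j) x v with hdb
  set ds := fderiv ℝ (fun y => (sideDist j y - sideDist i y) / √2) x v with hdsv
  set H := step (s / ε) with hHdef
  have hval : fderiv ℝ (cornerPotential α ε i j) x v =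
      H * deriv α a * da - (1 - H) * deriv α b * db
        - (1 - α a - α b) * (deriv step (s / ε) / ε) * ds := by
    refine Eq.trans hfd ?_
    simp
    ring
  have hvda : |da| ≤ ‖v‖ := by
    have := ContinuousLinearMap.le_of_opNorm_le _
      (norm_fderiv_le_of_lipschitz ℝ (x₀ := x) (lipschitz_sideDist i)) v
    simpa using this
  have hvdb : |db| ≤ ‖v‖ := by
    have := ContinuousLinearMap.le_of_opNorm_le _
      (norm_fderiv_le_of_lipschitz ℝ (x₀ := x) (lipschitz_sideDist j)) v
    simpa using this
  have hvds : |ds| ≤ ‖v‖ := by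
    have := ContinuousLinearMap.le_of_opNorm_le _
      (norm_fderiv_le_of_lipschitz ℝ (x₀ := x) (lipschitz_sub_sideDist hij.symm)) v
    simpa using this
  have hH0 : 0 ≤ H := step_nonneg _
  have hH1 : 0 ≤ 1 - H := sub_nonneg.2 (step_le_one _)
  have hst : 0 ≤ (1 - α a - α b) * (deriv step (s / ε) / ε) := hα.steepness_nonneg hε i j hx
  rw [hval]
  have e1 : |H * deriv α a * da| ≤ H * 2 * ‖v‖ := by
    rw [abs_mul, abs_mul, abs_of_nonneg hH0, abs_of_nonneg (hα.deriv_nonneg a)]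
    gcongr
    exact hα.deriv_le a
  have e2 : |(1 - H) * deriv α b * db| ≤ (1 - H) * 2 * ‖v‖ := by
    rw [abs_mul, abs_mul, abs_of_nonneg hH1, abs_of_nonneg (hα.deriv_nonneg b)]
    gcongr
    exact hα.deriv_le b
  have e3 : |(1 - α a - α b) * (deriv step (s / ε) / ε) * ds| ≤ steepness α ε i j x * ‖v‖ := by
    rw [abs_mul, abs_of_nonneg hst]
    exact mul_le_mul_of_nonneg_left hvds hst
  calc _ ≤ |H * deriv α a * da| + |(1 - H) * deriv α b * db| +
        |(1 - α a - α b) * (deriv step (s / ε) / ε) * ds| :=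
        (abs_sub _ _).trans (add_le_add (abs_sub _ _) le_rfl)
    _ ≤ H * 2 * ‖v‖ + (1 - H) * 2 * ‖v‖ + steepness α ε i j x * ‖v‖ :=
        add_le_add (add_le_add e1 e2) e3
    _ = (2 + steepness α ε i j x) * ‖v‖ := by ring

/-- A convex combination of two numbers in [0,1]; it supplies the dominating function for the
boundary integrals. -/
theorem IsCap.abs_cornerPotential_le (hα : IsCap δ α) (ε : ℝ) (i j : Fin 4) {x : Plane}
    (hx : x ∈ square) : |cornerPotential α ε i j x| ≤ 1 := by
  have hi := mem_square_iff.1 hx i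
  have hj := mem_square_iff.1 hx j
  have a0 := hα.nonneg _ hi
  have a1 := hα.le_half _ hi
  have b0 := hα.nonneg _ hj
  have b1 := hα.le_half _ hj
  set H := step ((sideDist j x - sideDist i x) / √2 / ε) with hH
  have hH0 : 0 ≤ H := step_nonneg _
  have hH1 : H ≤ 1 := step_le_one _
  rw [cornerPotential, ← hH, abs_le]
  constructor <;> nlinarith

/-- Off the corners the side keeps a positive distance from the diagonal, so the step is saturated
for small ε and the limit value is attained. -/
theorem IsCap.tendsto_cornerPotential_left (hα : IsCap δ α) {i j : Fin 4} (hij : i ≠ j)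
    {x : Plane} (hx : x ∈ openSide i) :
    Tendsto (fun ε => cornerPotential α ε i j x) (𝓝[>] 0) (𝓝 0) := by
  have hi := (mem_side_iff.1 (openSide_subset_side _ hx)).2
  have hj := sideDist_pos_of_mem_openSide hij.symm hx
  have hpos : 0 < sideDist j x / √2 := by positivity
  refine tendsto_const_nhds.congr' ?_
  filter_upwards [Ioo_mem_nhdsGT hpos] with ε hε
  rw [cornerPotential, hi, hα.zero, sub_zero, step_eq_one]
  · ring
  · rw [one_le_div hε.1]; exact hε.2.le

theorem IsCap.tendsto_cornerPotential_right (hα : IsCap δ α) {i j : Fin 4} (hij : i ≠ j)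
    {x : Plane} (hx : x ∈ openSide j) :
    Tendsto (fun ε => cornerPotential α ε i j x) (𝓝[>] 0) (𝓝 1) := by
  have hj := (mem_side_iff.1 (openSide_subset_side _ hx)).2
  have hi := sideDist_pos_of_mem_openSide hij hx
  have hpos : 0 < sideDist i x / √2 := by positivity
  refine tendsto_const_nhds.congr' ?_
  filter_upwards [Ioo_mem_nhdsGT hpos] with ε hε
  rw [cornerPotential, hj, hα.zero, zero_sub, step_eq_zero]
  · ring
  · rw [neg_div, neg_div, neg_le_neg_iff, one_le_div hε.1]; exact hε.2.le

/-- On the diagonal the two side distances agree, so the jump is 1 - 2α. The kernel is reflected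
when the signed distance has the opposite sign to y - d x, and the integral is reflected when the
common corner lies on the right side. -/
theorem IsCap.tendsto_integral_steepness (hα : IsCap δ α) {i j : Fin 4} (hij : Adjacent i j)
    (hlt : i < j) :
    Tendsto (fun ε => ∫ x in square, steepness α ε i j x) (𝓝[>] 0)
      (𝓝 (√2 * ∫ t in Icc (0 : ℝ) 1, (1 - 2 * α t))) := by
  have hc := hα.contDiff.continuous
  have hneg : HasCompactSupport fun u => deriv step (-u) :=
    hasCompactSupport_deriv_step.comp_homeomorph (Homeomorph.neg ℝ)
  have hone : ∫ u, deriv step (-u) = 1 := by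
    rw [integral_neg_eq_self (deriv step) volume, integral_deriv_step]
  have hcn : Continuous fun u => deriv step (-u) := continuous_deriv_step.comp continuous_neg
  have hw : ∀ k l, Continuous fun x => 1 - α (sideDist k x) - α (sideDist l x) := by
    intro k l; fun_prop
  have hflip : ∀ x ∈ Ioo (0 : ℝ) 1, 1 - x ∈ Ioo (0 : ℝ) 1 := fun x hx =>
    ⟨by linarith [hx.2], by linarith [hx.1]⟩
  have hrefl := integral_Icc_comp_one_sub fun t => 1 - 2 * α t
  revert hij hlt
  fin_cases i <;> fin_cases j <;> intro hij hlt <;>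
    first | exact absurd hij (by decide) | exact absurd hlt (by decide) | skip
  · convert tendsto_integral_smear (hw 0 1) continuous_deriv_step hasCompactSupport_deriv_step
      (d := fun x => x) (by fun_prop) (fun x hx => hx) using 2
    · refine setIntegral_congr_fun measurableSet_square fun x _ => ?_
      simp only [steepness, sideDist, div_div]
    · rw [integral_deriv_step, ← integral_const_mul]
      refine setIntegral_congr_fun measurableSet_Icc fun x _ => ?_
      simp [sideDist]
      ring
  · convert tendsto_integral_smear (hw 0 3) hcn hneg
      (d := fun x => 1 - x) (by fun_prop) hflip using 2
    · refine setIntegral_congr_fun measurableSet_square fun x _ => ?_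
      simp only [steepness, sideDist, div_div, ← neg_div]
      congr 4; ring
    · rw [hone, ← integral_const_mul]
      refine setIntegral_congr_fun measurableSet_Icc fun x _ => ?_
      simp [sideDist]
      ring
  · convert tendsto_integral_smear (hw 1 2) hcn hneg
      (d := fun x => 1 - x) (by fun_prop) hflip using 2
    · refine setIntegral_congr_fun measurableSet_square fun x _ => ?_
      simp only [steepness, sideDist, div_div, ← neg_div]
      congr 4; ring
    · rw [hone, ← hrefl, ← integral_const_mul]
      refine setIntegral_congr_fun measurableSet_Icc fun x _ => ?_
      simp [sideDist]
      ring
  · convert tendsto_integral_smear (hw 2 3) hcn hneg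
      (d := fun x => x) (by fun_prop) (fun x hx => hx) using 2
    · refine setIntegral_congr_fun measurableSet_square fun x _ => ?_
      simp only [steepness, sideDist, div_div, ← neg_div]
      congr 4; ring
    · rw [hone, ← hrefl, ← integral_const_mul]
      refine setIntegral_congr_fun measurableSet_Icc fun x _ => ?_
      simp [sideDist]
      ring

theorem IsCap.integral_one_sub_le (hα : IsCap δ α) :
    ∫ t in Icc (0 : ℝ) 1, (1 - 2 * α t) ≤ 1 / 8 + 4 * δ := by
  have hc := hα.contDiff.continuous
  have h1 : Continuous fun t => 1 - 2 * α t := by fun_prop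
  have h2 : Continuous fun t : ℝ => max 0 (1 - 4 * t) := by fun_prop
  calc ∫ t in Icc (0 : ℝ) 1, (1 - 2 * α t)
      ≤ ∫ t in Icc (0 : ℝ) 1, (max 0 (1 - 4 * t) + 4 * δ) :=
        setIntegral_mono_on h1.continuousOn.integrableOn_Icc
          (h2.add continuous_const).continuousOn.integrableOn_Icc measurableSet_Icc
          fun t ht => hα.one_sub_le t ht.1
    _ = 1 / 8 + 4 * δ := by
        rw [integral_add h2.continuousOn.integrableOn_Icc
          continuous_const.continuousOn.integrableOn_Icc, integral_max_one_sub_four_mul]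
        simp

/-! ## Multiflows -/

/-- The test function for the component flow `v_ij`: about `0` on the side `i` and, on the side
`j`, the number of the regions `AB`, `BC` that separate `i` from `j`. -/
noncomputable def potential (α : ℝ → ℝ) (ε : ℝ) (p : Fin 4 × Fin 4) : Plane → ℝ :=
  if Adjacent p.1 p.2 then cornerPotential α ε p.1 p.2 else fun x => 2 * sideDist p.1 x

/-- A common bound for the gradients of the test functions. -/
noncomputable def gradientBound (α : ℝ → ℝ) (ε : ℝ) (x : Plane) : ℝ :=
  2 + ∑ p ∈ pairs with Adjacent p.1 p.2, steepness α ε p.1 p.2 x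

theorem opposite_of_mem_pairs {p : Fin 4 × Fin 4} (hp : p ∈ pairs) (h : ¬ Adjacent p.1 p.2) :
    p.2 = p.1 + 2 := by
  revert p; decide

theorem lt_of_mem_pairs {p : Fin 4 × Fin 4} (hp : p ∈ pairs) : p.1 < p.2 :=
  (Finset.mem_filter.1 hp).2

theorem IsCap.contDiff_potential (hα : IsCap δ α) (ε : ℝ) (p : Fin 4 × Fin 4) :
    ContDiff ℝ ∞ (potential α ε p) := by
  unfold potential
  split_ifs
  · exact hα.contDiff_cornerPotential ε p.1 p.2
  · exact contDiff_const.mul (contDiff_sideDist p.1)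

theorem IsCap.continuous_gradientBound (hα : IsCap δ α) (ε : ℝ) :
    Continuous (gradientBound α ε) :=
  continuous_const.add (continuous_finsetSum _ fun p _ => hα.continuous_steepness ε p.1 p.2)

theorem IsCap.abs_fderiv_potential_le (hα : IsCap δ α) {ε : ℝ} (hε : 0 < ε) {p : Fin 4 × Fin 4}
    (hp : p ∈ pairs) {x : Plane} (hx : x ∈ square) (v : Plane) :
    |fderiv ℝ (potential α ε p) x v| ≤ gradientBound α ε x * ‖v‖ := by
  have hnn : ∀ q ∈ pairs.filter (fun q => Adjacent q.1 q.2), 0 ≤ steepness α ε q.1 q.2 x :=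
    fun q _ => hα.steepness_nonneg hε q.1 q.2 hx
  unfold potential gradientBound
  split_ifs with h
  · refine (hα.abs_fderiv_cornerPotential_le hε h hx v).trans ?_
    gcongr
    exact Finset.single_le_sum (f := fun q => steepness α ε q.1 q.2 x) hnn
      (Finset.mem_filter.2 ⟨hp, h⟩)
  · have hd := (contDiff_sideDist p.1).differentiable (by simp) x
    rw [fderiv_const_mul hd]
    have := ContinuousLinearMap.le_of_opNorm_le _
      (norm_fderiv_le_of_lipschitz ℝ (x₀ := x) (lipschitz_sideDist p.1)) v
    rw [NNReal.coe_one, one_mul, Real.norm_eq_abs] at this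
    have hsum := Finset.sum_nonneg hnn
    rw [smul_apply, smul_eq_mul, abs_mul, abs_two, add_mul]
    have := mul_nonneg hsum (norm_nonneg v)
    linarith

theorem IsCap.tendsto_integral_gradientBound (hα : IsCap δ α) :
    Tendsto (fun ε => ∫ x in square, gradientBound α ε x) (𝓝[>] 0)
      (𝓝 (2 + 4 * (√2 * ∫ t in Icc (0 : ℝ) 1, (1 - 2 * α t)))) := by
  have hi : ∀ ε (p : Fin 4 × Fin 4),
      Integrable (steepness α ε p.1 p.2) (volume.restrict square) := fun ε p =>
    (hα.continuous_steepness ε p.1 p.2).continuousOn.integrableOn_compact isCompact_square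
  have hI2 : Integrable (fun _ : Plane => (2 : ℝ)) (volume.restrict square) :=
    integrableOn_const (by simp [volume_square])
  have h := (tendsto_finsetSum (pairs.filter fun p => Adjacent p.1 p.2) fun p hp =>
    hα.tendsto_integral_steepness (Finset.mem_filter.1 hp).2
      (lt_of_mem_pairs (Finset.mem_filter.1 hp).1)).const_add 2
  rw [Finset.sum_const, show (pairs.filter fun p => Adjacent p.1 p.2).card = 4 by decide,
    nsmul_eq_mul, Nat.cast_ofNat] at h
  refine h.congr fun ε => ?_
  unfold gradientBound
  rw [integral_add hI2 (integrable_finsetSum _ fun p _ => hi ε p),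
    integral_finsetSum _ fun p _ => hi ε p]
  simp [measureReal_def, volume_square]

theorem sidePoint_mem_square (k : Fin 4) {t : ℝ} (ht : t ∈ Icc (0 : ℝ) 1) :
    sidePoint k t ∈ square :=
  (mem_side_iff.1 ⟨t, ht, rfl⟩).1

@[fun_prop]
theorem continuous_sidePoint (k : Fin 4) : Continuous (sidePoint k) := by
  fin_cases k <;> unfold sidePoint <;> fun_prop

namespace NuVMultiflow

variable (V : NuVMultiflow)

/-- The inward flux of the component `v_p` through the side `k`. -/
noncomputable def sideFlux (p : Fin 4 × Fin 4) (k : Fin 4) : ℝ :=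
  ∫ t in (0 : ℝ)..1, V.trace p k t

variable {V} {p : Fin 4 × Fin 4}

theorem intervalIntegrable_trace (hp : p ∈ pairs) (k : Fin 4) :
    IntervalIntegrable (V.trace p k) volume 0 1 :=
  (intervalIntegrable_iff_integrableOn_Icc_of_le zero_le_one).2 ((V.divFree p hp).1 k)

theorem integral_trace_mul_eq_zero (hp : p ∈ pairs) {k : Fin 4} (h1 : k ≠ p.1) (h2 : k ≠ p.2)
    (φ : ℝ → ℝ) : ∫ t in (0 : ℝ)..1, V.trace p k t * φ t = 0 := by
  rw [intervalIntegral.integral_of_le zero_le_one, ← integral_Icc_eq_integral_Ioc]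
  refine integral_eq_zero_of_ae ?_
  filter_upwards [V.trace_eq_zero p hp k h1 h2] with t ht
  simp [ht]

theorem sideFlux_eq_zero (hp : p ∈ pairs) {k : Fin 4} (h1 : k ≠ p.1) (h2 : k ≠ p.2) :
    V.sideFlux p k = 0 := by
  simpa [sideFlux] using integral_trace_mul_eq_zero (V := V) hp h1 h2 fun _ => 1

/-- Green's formula for a component flow. -/
theorem integral_fderiv_apply (hp : p ∈ pairs) {φ : Plane → ℝ} (hφ : ContDiff ℝ ∞ φ) :
    ∫ x in square, fderiv ℝ φ x (V.field p x) =
      -((∫ t in (0 : ℝ)..1, V.trace p p.1 t * φ (sidePoint p.1 t)) +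
        ∫ t in (0 : ℝ)..1, V.trace p p.2 t * φ (sidePoint p.2 t)) := by
  rw [(V.divFree p hp).2 φ hφ, Finset.sum_eq_add p.1 p.2 (lt_of_mem_pairs hp).ne]
  · exact fun k _ hk => integral_trace_mul_eq_zero hp hk.1 hk.2 _
  · simp
  · simp

/-- Green's formula tested on the constant 1. -/
theorem sideFlux_add (hp : p ∈ pairs) : V.sideFlux p p.1 + V.sideFlux p p.2 = 0 := by
  have := integral_fderiv_apply (V := V) hp (φ := fun _ => 1) contDiff_const
  simp at this
  unfold sideFlux
  linarith

/-- A component with both indices on the same side of the cut drops out. If it enters with sign -1,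
its flux through its second side is the negative of that through its first, so the signs cancel and
the orientation disappears. -/
theorem flux_eq (V : NuVMultiflow) (I : Finset (Fin 4)) : V.flux I =
    ∑ p ∈ pairs, if (p.1 ∈ I ∧ p.2 ∈ Iᶜ) ∨ (p.1 ∈ Iᶜ ∧ p.2 ∈ I) then V.sideFlux p p.1 else 0 := by
  have h1 : V.flux I = ∑ p ∈ pairs, crossSign I p * ∑ k ∈ I, V.sideFlux p k := by
    unfold flux sideFlux
    simp_rw [Finset.mul_sum]
    rw [Finset.sum_comm]
    refine Finset.sum_congr rfl fun k _ => ?_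
    rw [intervalIntegral.integral_finsetSum fun p hp =>
      (intervalIntegrable_trace hp k).const_mul _]
    simp_rw [intervalIntegral.integral_const_mul]
  rw [h1]
  refine Finset.sum_congr rfl fun p hp => ?_
  have hadd := sideFlux_add (V := V) hp
  have hone : ∀ i j : Fin 4, i ∈ I → j ∉ I → (∀ k, k ≠ i → k ≠ j → V.sideFlux p k = 0) →
      ∑ k ∈ I, V.sideFlux p k = V.sideFlux p i := fun i j hi hj h =>
    Finset.sum_eq_single_of_mem i hi fun k hk hki => h k hki fun hkj => hj (hkj ▸ hk)
  simp only [crossSign, Finset.mem_compl]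
  by_cases hi : p.1 ∈ I <;> by_cases hj : p.2 ∈ I <;> simp only [hi, hj, not_true, not_false_eq_true,
    and_true, and_false, or_self, or_true, true_or, if_true, if_false, zero_mul]
  · rw [hone p.1 p.2 hi hj fun k h1 h2 => sideFlux_eq_zero hp h1 h2, one_mul]
  · rw [hone p.2 p.1 hj hi fun k h2 h1 => sideFlux_eq_zero hp h1 h2]
    linarith

theorem flux_add_flux (V : NuVMultiflow) : V.flux AB + V.flux BC =
    ∑ p ∈ pairs, (sepNumber {AB, BC} p.1 p.2 : ℝ) * V.sideFlux p p.1 := by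
  rw [flux_eq, flux_eq, ← Finset.sum_add_distrib]
  refine Finset.sum_congr rfl fun p _ => ?_
  rw [sepNumber_eq]
  push_cast
  rw [add_mul, ite_mul, ite_mul, one_mul, zero_mul]

theorem tendsto_integral_trace_mul (hp : p ∈ pairs) (hα : IsCap δ α) {i j : Fin 4} (k : Fin 4)
    {c : ℝ} (hlim : ∀ x ∈ openSide k, Tendsto (fun ε => cornerPotential α ε i j x) (𝓝[>] 0) (𝓝 c)) :
    Tendsto (fun ε => ∫ t in (0 : ℝ)..1,
      V.trace p k t * cornerPotential α ε i j (sidePoint k t)) (𝓝[>] 0)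
      (𝓝 (∫ t in (0 : ℝ)..1, V.trace p k t * c)) := by
  have hg := intervalIntegrable_trace (V := V) hp k
  refine intervalIntegral.tendsto_integral_filter_of_dominated_convergence
    (fun t => ‖V.trace p k t‖) ?_ ?_ hg.norm ?_
  · refine Eventually.of_forall fun ε => ?_
    have hc := (hα.contDiff_cornerPotential ε i j).continuous
    rw [uIoc_of_le zero_le_one]
    exact hg.1.aestronglyMeasurable.mul
      (hc.comp (continuous_sidePoint k)).aestronglyMeasurable
  · refine Eventually.of_forall fun ε => ae_of_all _ fun t ht => ?_
    rw [uIoc_of_le zero_le_one] at ht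
    rw [norm_mul]
    exact mul_le_of_le_one_right (norm_nonneg _)
      (hα.abs_cornerPotential_le ε i j (sidePoint_mem_square k (Ioc_subset_Icc_self ht)))
  -- The half-open interval of integration still contains one corner, where the pointwise limit is
  -- not available.
  · have : ∀ᵐ t : ℝ, t ≠ 1 := by simp [ae_iff]
    filter_upwards [this] with t ht1 ht
    rw [uIoc_of_le zero_le_one] at ht
    exact (hlim _ ⟨t, ⟨ht.1, lt_of_le_of_ne ht.2 ht1⟩, rfl⟩).const_mul _

/-- The flux of a component is, in the limit, the pairing with the gradient of its test function. -/
theorem tendsto_integral_fderiv_potential (hp : p ∈ pairs) (hα : IsCap δ α) :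
    Tendsto (fun ε => ∫ x in square, fderiv ℝ (potential α ε p) x (V.field p x)) (𝓝[>] 0)
      (𝓝 ((sepNumber {AB, BC} p.1 p.2 : ℝ) * V.sideFlux p p.1)) := by
  have hadd := sideFlux_add (V := V) hp
  simp_rw [integral_fderiv_apply hp (hα.contDiff_potential _ p)]
  by_cases h : Adjacent p.1 p.2
  · have h1 := tendsto_integral_trace_mul (V := V) hp hα p.1 fun x hx =>
      hα.tendsto_cornerPotential_left h.1 hx
    have h2 := tendsto_integral_trace_mul (V := V) hp hα p.2 fun x hx =>
      hα.tendsto_cornerPotential_right h.1 hx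
    have := (h1.add h2).neg
    simp only [potential, if_pos h]
    convert this using 2
    rw [sepNumber_of_adjacent h]
    unfold sideFlux at hadd ⊢
    simp
    linarith
  · have hopp := opposite_of_mem_pairs hp h
    have hpt : ∀ t, sideDist p.1 (sidePoint p.2 t) = 1 := fun t => by
      have e1 := sideDist_add_opposite p.1 (sidePoint p.2 t)
      have e2 := sideDist_sidePoint_self p.2 t
      rw [← hopp] at e1
      linarith
    -- For opposite sides the potential 2 `sideDist` does not depend on ε and takes the exact values
    -- 0 and 2 on the two sides.
    refine tendsto_const_nhds.congr fun ε => ?_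
    rw [show sepNumber {AB, BC} p.1 p.2 = 2 by rw [hopp, sepNumber_opposite]]
    simp only [potential, if_neg h, hpt, sideDist_sidePoint_self]
    unfold sideFlux at hadd ⊢
    simp
    linarith

/-- Weak duality at fixed δ: the pairings with the potentials are summed under one integral, where a
common gradient bound factors out of ∑ |v_ij| ≤ 1; then ε → 0. -/
theorem flux_add_flux_le_of_isCap (V : NuVMultiflow) (hα : IsCap δ α) :
    V.flux AB + V.flux BC ≤ 2 + 4 * (√2 * ∫ t in Icc (0 : ℝ) 1, (1 - 2 * α t)) := by
  rw [flux_add_flux]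
  refine le_of_tendsto_of_tendsto
    (tendsto_finsetSum _ fun p hp => tendsto_integral_fderiv_potential hp hα)
    hα.tendsto_integral_gradientBound ?_
  filter_upwards [self_mem_nhdsWithin] with ε hε
  have hbound : IntegrableOn (gradientBound α ε) square :=
    (hα.continuous_gradientBound ε).continuousOn.integrableOn_compact isCompact_square
  have hpos : ∀ x ∈ square, 0 ≤ gradientBound α ε x := fun x hx =>
    add_nonneg zero_le_two (Finset.sum_nonneg fun p _ => hα.steepness_nonneg hε p.1 p.2 hx)
  have hint : ∀ p ∈ pairs, IntegrableOn
      (fun x => fderiv ℝ (potential α ε p) x (V.field p x)) square := by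
    intro p hp
    refine Integrable.mono' hbound ?_ ?_
    · have hc : Continuous fun q : (Plane →L[ℝ] ℝ) × Plane => q.1 q.2 := by fun_prop
      exact hc.comp_aestronglyMeasurable
        (((hα.contDiff_potential ε p).continuous_fderiv (by simp)).aestronglyMeasurable.prodMk
          (V.aestronglyMeasurable p hp))
    · filter_upwards [V.density_le, ae_restrict_mem measurableSet_square] with x hx hxs
      refine (hα.abs_fderiv_potential_le hε hp hxs _).trans ?_
      refine mul_le_of_le_one_right (hpos x hxs) (le_trans ?_ hx)
      exact Finset.single_le_sum (f := fun p => ‖V.field p x‖) (fun _ _ => norm_nonneg _) hp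
  rw [← integral_finsetSum _ hint]
  refine integral_mono_ae (integrable_finsetSum _ hint) hbound ?_
  filter_upwards [V.density_le, ae_restrict_mem measurableSet_square] with x hx hxs
  calc ∑ p ∈ pairs, fderiv ℝ (potential α ε p) x (V.field p x)
      ≤ ∑ p ∈ pairs, gradientBound α ε x * ‖V.field p x‖ := Finset.sum_le_sum fun p hp =>
        (le_abs_self _).trans (hα.abs_fderiv_potential_le hε hp hxs _)
    _ = gradientBound α ε x * ∑ p ∈ pairs, ‖V.field p x‖ := (Finset.mul_sum _ _ _).symm
    _ ≤ gradientBound α ε x := mul_le_of_le_one_right (hpos x hxs) hx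

/-- The limit δ → 0 turns the four jumps into 4 · √2/8. -/
theorem flux_add_flux_le (V : NuVMultiflow) : V.flux AB + V.flux BC ≤ 2 + √2 / 2 := by
  have h : ∀ δ ∈ Ioo (0 : ℝ) (1 / 4),
      V.flux AB + V.flux BC ≤ 2 + 4 * (√2 * (1 / 8 + 4 * δ)) := by
    intro δ hδ
    obtain ⟨α, hα⟩ := exists_isCap hδ.1 hδ.2.le
    refine (V.flux_add_flux_le_of_isCap hα).trans ?_
    gcongr
    exact hα.integral_one_sub_le
  have ht : Tendsto (fun δ : ℝ => 2 + 4 * (√2 * (1 / 8 + 4 * δ))) (𝓝[>] 0) (𝓝 (2 + √2 / 2)) := by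
    have hc : Continuous fun δ : ℝ => 2 + 4 * (√2 * (1 / 8 + 4 * δ)) := by fun_prop
    have := (hc.tendsto 0).mono_left (nhdsWithin_le_nhds (s := Ioi 0))
    convert this using 2
    ring
  refine ge_of_tendsto ht ?_
  filter_upwards [Ioo_mem_nhdsGT (show (0 : ℝ) < 1 / 4 by norm_num)] with δ hδ using h δ hδ

end NuVMultiflow

theorem toReal_S_AB : (S AB).toReal = √2 := by
  rw [S_AB, ENNReal.toReal_ofReal (by positivity)]

theorem toReal_S_BC : (S BC).toReal = √2 := by
  rw [S_BC, ENNReal.toReal_ofReal (by positivity)]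

theorem NuVMultiflow.not_locksByFlux (V : NuVMultiflow) : ¬ V.LocksByFlux {AB, BC} := by
  intro h
  have hle := V.flux_add_flux_le
  rw [h AB (by simp), h BC (by simp), toReal_S_AB, toReal_S_BC] at hle
  exact absurd hle (not_le.2 two_add_lt)

end BitThread

theorem mainTheorem4 :
    -- the minimal surfaces of `AB` and `BC` are the diagonals, and `S(AB) + S(BC) = 2√2`
    (IsHomologousSurface AB diagAB ∧ μH[1] diagAB = S AB ∧ S AB = ENNReal.ofReal √2) ∧
    (IsHomologousSurface BC diagBC ∧ μH[1] diagBC = S BC ∧ S BC = ENNReal.ofReal √2) ∧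
    2 + √2 / 2 < (S AB).toReal + (S BC).toReal ∧ (S AB).toReal + (S BC).toReal = 2 * √2 ∧
    -- the function `λ` is feasible for the dual program, with objective `2 + √2 / 2`
    (IsDualFeasible {AB, BC} dualFun ∧ HasDualObjective dualFun (2 + √2 / 2)) ∧
    -- multiflows, with a bound that also holds in the limit
    (∀ V : NuVMultiflow,
      V.flux AB + V.flux BC ≤ 2 + √2 / 2 ∧
      ¬ V.LocksByFlux {AB, BC} ∧
      ∀ {Ω : Type*} [MeasurableSpace Ω] (P : ThreadConfiguration Ω),
        P.Underlies V → ¬ P.Locks {AB, BC}) ∧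
    -- thread configurations
    (∀ {Ω : Type*} [MeasurableSpace Ω] (P : ThreadConfiguration Ω), P.NuVLeOne →
      P.number AB + P.number BC ≤ ENNReal.ofReal (2 + √2 / 2) ∧
      ¬ P.Locks {AB, BC}) := by
  refine ⟨⟨isHomologousSurface_diagAB, hausdorffMeasure_diagAB.trans S_AB.symm, S_AB⟩,
    ⟨isHomologousSurface_diagBC, hausdorffMeasure_diagBC.trans S_BC.symm, S_BC⟩, ?_, ?_,
    ⟨isDualFeasible_dualFun, hasDualObjective_dualFun⟩, fun V => ⟨V.flux_add_flux_le,
      V.not_locksByFlux, fun P hP => ThreadConfiguration.not_locks hP.nuVLeOne⟩,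
    fun P hP => ⟨ThreadConfiguration.number_add_number_le hP, ThreadConfiguration.not_locks hP⟩⟩
  · rw [toReal_S_AB, toReal_S_BC]
    exact two_add_lt
  · rw [toReal_S_AB, toReal_S_BC, two_mul]
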